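/- Let $F$ be a field of characteristic different from $3$ containing a primitive cube root of unity $\rho$, and let $r,e,t,\alpha,\beta,\gamma,\delta\in F$ with $\alpha\neq 0$. Put $$\Phi(Z,X,Y)=Z^3-rYZ^2-(eXY+tY^2)Z-(\alpha X^3+\beta X^2Y+\gamma XY^2+\delta Y^3),$$ and let $C_\Phi$ be its generalized Clifford algebra, i.e. the quotient of the free associative algebra $F\langle x,y\rangle$ by the two-sided ideal generated by the elements $\Phi(ax+by,a,b)$, $a,b\in F$. Then $x^3=\alpha$ in $C_\Phi$, so $x$ is invertible; for $k=0,1,2$ put $$y_k=\tfrac13\left(y+\rho^k xyx^{-1}+\rho^{2k}x^2yx^{-2}\right),$$ so that $y=y_0+y_1+y_2$ and $y_kx=\rho^kxy_k$. Put $$D_1=\gamma+\frac{er}{3}-\frac{\beta^2}{3\alpha},\qquad D_2=e\beta-3\alpha t-\alpha r^2,$$ $$D=\frac{e^3}{27\alpha}+\frac{\beta^3}{27\alpha^2}-\frac{2r^3}{27}+\frac{\beta}{3\alpha}D_1-\frac{rt}{3}-\delta,\qquad w=x^{-1}y_2y_1+\rho^2\frac{D_1}{3\alpha}x+\frac{D_2}{9\alpha}x^{-1}.$$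 Let $E$ be the affine plane cubic $$E:\quad (D-\rho^2eR)S+S^2+\alpha R^3-\frac{D_1^3}{27\alpha}-\frac{D_2^3}{729\alpha^3}-\rho^2\frac{D_1D_2}{9\alpha}R=0,$$ with coordinate ring $F[E]=F[R,S]/(E)$, and assume that the discriminant of $E$ is nonzero. (In the coordinates $-\alpha R$, $\alpha S$ the curve is in Weierstrass form with $a_1=\rho^2e$, $a_2=0$, $a_3=\alpha D$, $a_4=-\rho^2D_1D_2/9$, $a_6=\alpha D_1^3/27+D_2^3/(729\alpha)$.) (1) The center of $C_\Phi$ is $F[y_1^3,w]$, and there is an $F$-algebra isomorphism from $F[E]$ onto it with $R\mapsto w$ and $S\mapsto y_1^3$. (2) If moreover $D\neq0$ and $F[x:x^3=\alpha]=F[T]/(T^3-\alpha)$ is a field, then $C_\Phi$ is an Azumaya algebra of constant rank $9$ over its center. -/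

import Mathlib

/-- An algebra as an algebra over its center, by multiplication. -/
instance centerAlgebra {F A : Type*} [CommRing F] [Ring A] [Algebra F A] :
    Algebra (Subalgebra.center F A) A where
  algebraMap := (Subalgebra.center F A).val.toRingHom
  commutes' z a := (Subalgebra.mem_center_iff.1 z.2 a).symm
  smul_def' _ _ := rfl

/-- The defining relations of the generalized Clifford algebra of a polynomial
`Φ(Z, X_i : i ∈ σ)`, viewed as a polynomial in `Z` over `F[X_i : i ∈ σ]`: for every `a : σ → F`,
the element `∑ a_i x_i` of the free algebra is a root of `Φ(Z, a)`. -/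
inductive GenCliffordRel {F σ : Type*} [Field F] [Fintype σ]
    (Φ : Polynomial (MvPolynomial σ F)) : FreeAlgebra F σ → FreeAlgebra F σ → Prop
  | of (a : σ → F) : GenCliffordRel Φ
      (Polynomial.aeval (∑ i, a i • FreeAlgebra.ι F i) (Φ.map (MvPolynomial.eval a))) 0

/-- The generalized Clifford algebra `C_Φ`. -/
abbrev GenClifford {F σ : Type*} [Field F] [Fintype σ]
    (Φ : Polynomial (MvPolynomial σ F)) : Type _ :=
  RingQuot (GenCliffordRel Φ)

/-- The generator `x_i` of `C_Φ`. -/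
noncomputable def GenClifford.gen {F σ : Type*} [Field F] [Fintype σ]
    (Φ : Polynomial (MvPolynomial σ F)) (i : σ) : GenClifford Φ :=
  RingQuot.mkAlgHom F (GenCliffordRel Φ) (FreeAlgebra.ι F i)

/-- The coefficients of
`Φ(Z,X,Y) = Z³ - r Y Z² - (e XY + t Y²) Z - (α X³ + β X²Y + γ XY² + δ Y³)`. -/
structure CubicCoeffs (F : Type*) where
  (r e t α β γ δ : F)

namespace CubicCoeffs

variable {F : Type*} [Field F] (c : CubicCoeffs F)

/-- `Φ(Z,X,Y)` as a polynomial in `Z` over `F[X,Y]`; the variables `X`, `Y` have index `0`, `1`. -/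
noncomputable def Phi : Polynomial (MvPolynomial (Fin 2) F) :=
  letI X : MvPolynomial (Fin 2) F := MvPolynomial.X 0
  letI Y : MvPolynomial (Fin 2) F := MvPolynomial.X 1
  letI k : F →+* MvPolynomial (Fin 2) F := MvPolynomial.C
  letI Z : Polynomial (MvPolynomial (Fin 2) F) := Polynomial.X
  Z ^ 3 - Polynomial.C (k c.r * Y) * Z ^ 2
    - Polynomial.C (k c.e * X * Y + k c.t * Y ^ 2) * Z
    - Polynomial.C (k c.α * X ^ 3 + k c.β * X ^ 2 * Y + k c.γ * X * Y ^ 2 + k c.δ * Y ^ 3)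

/-- The algebra `C_Φ` of the cubic `Φ`. -/
abbrev Cliff : Type _ := GenClifford c.Phi

noncomputable def x : c.Cliff := GenClifford.gen c.Phi 0

noncomputable def y : c.Cliff := GenClifford.gen c.Phi 1

/-- `x⁻¹ = α⁻¹ x²` (when `α ≠ 0`, see `x_mul_xInv` and `xInv_mul_x`). -/
noncomputable def xInv : c.Cliff := c.α⁻¹ • c.x ^ 2

/-- The component `y_k` of `y` in the eigenvector decomposition for conjugation by `x`:
`y_k = (1/3) (y + ρᵏ x y x⁻¹ + ρ²ᵏ x² y x⁻²)`
(see `yComp_sum` and `yComp_mul_x`). -/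
noncomputable def yComp (ρ : F) (k : ℕ) : c.Cliff :=
  (3 : F)⁻¹ • (c.y + ρ ^ k • (c.x * c.y * c.xInv)
    + ρ ^ (2 * k) • (c.x ^ 2 * c.y * c.xInv ^ 2))

/-- `D₁ = γ + er/3 - β²/(3α)`. -/
def D₁ : F := c.γ + c.e * c.r / 3 - c.β ^ 2 / (3 * c.α)

/-- `D₂ = eβ - 3αt - αr²`. -/
def D₂ : F := c.e * c.β - 3 * c.α * c.t - c.α * c.r ^ 2

/-- `D = e³/(27α) + β³/(27α²) - 2r³/27 + βD₁/(3α) - rt/3 - δ`. -/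
def D : F := c.e ^ 3 / (27 * c.α) + c.β ^ 3 / (27 * c.α ^ 2) - 2 * c.r ^ 3 / 27
  + c.β / (3 * c.α) * c.D₁ - c.r * c.t / 3 - c.δ

/-- `w = x⁻¹ y₂ y₁ + ρ² D₁/(3α) x + D₂/(9α) x⁻¹`. -/
noncomputable def w (ρ : F) : c.Cliff :=
  c.xInv * c.yComp ρ 2 * c.yComp ρ 1 + (ρ ^ 2 * (c.D₁ / (3 * c.α))) • c.x
    + (c.D₂ / (9 * c.α)) • c.xInv

/-- The polynomial in the variables `R` (index `0`) and `S` (index `1`) that defines `E`. -/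
noncomputable def curvePoly (ρ : F) : MvPolynomial (Fin 2) F :=
  letI R : MvPolynomial (Fin 2) F := MvPolynomial.X 0
  letI S : MvPolynomial (Fin 2) F := MvPolynomial.X 1
  letI k : F →+* MvPolynomial (Fin 2) F := MvPolynomial.C
  (k c.D - k (ρ ^ 2 * c.e) * R) * S + S ^ 2 + k c.α * R ^ 3
    - k (c.D₁ ^ 3 / (27 * c.α)) - k (c.D₂ ^ 3 / (729 * c.α ^ 3))
    - k (ρ ^ 2 * (c.D₁ * c.D₂ / (9 * c.α))) * R

/-- The affine coordinate ring `F[E] = F[R,S] / (equation of E)`. -/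
abbrev CoordRing (ρ : F) : Type _ :=
  MvPolynomial (Fin 2) F ⧸ Ideal.span {c.curvePoly ρ}

/-- The Weierstrass form of `E`, in the coordinates `(-αR, αS)` (see `weierstrass_equation_iff`).
Its discriminant is the discriminant of `E`. -/
def weierstrass (ρ : F) : WeierstrassCurve F where
  a₁ := ρ ^ 2 * c.e
  a₂ := 0
  a₃ := c.α * c.D
  a₄ := -(ρ ^ 2 * (c.D₁ * c.D₂ / 9))
  a₆ := c.α * c.D₁ ^ 3 / 27 + c.D₂ ^ 3 / (729 * c.α)

theorem weierstrass_equation_iff {ρ : F} (hα : c.α ≠ 0) (h3 : (3 : F) ≠ 0) (R S : F) :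
    (c.weierstrass ρ).toAffine.Equation (-(c.α * R)) (c.α * S) ↔
      MvPolynomial.eval ![R, S] (c.curvePoly ρ) = 0 := by
  have h9 : (9 : F) ≠ 0 := by
    have : (9 : F) = 3 ^ 2 := by norm_num
    rw [this]; exact pow_ne_zero _ h3
  have h27 : (27 : F) ≠ 0 := by
    have : (27 : F) = 3 ^ 3 := by norm_num
    rw [this]; exact pow_ne_zero _ h3
  have h729 : (729 : F) ≠ 0 := by
    have : (729 : F) = 3 ^ 6 := by norm_num
    rw [this]; exact pow_ne_zero _ h3
  have key : (c.α * S) ^ 2 + (c.weierstrass ρ).a₁ * (-(c.α * R)) * (c.α * S)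
      + (c.weierstrass ρ).a₃ * (c.α * S)
      - ((-(c.α * R)) ^ 3 + (c.weierstrass ρ).a₂ * (-(c.α * R)) ^ 2
        + (c.weierstrass ρ).a₄ * (-(c.α * R)) + (c.weierstrass ρ).a₆)
      = c.α ^ 2 * MvPolynomial.eval ![R, S] (c.curvePoly ρ) := by
    simp only [weierstrass, curvePoly, map_add, map_sub, map_mul, map_pow, MvPolynomial.eval_C,
      MvPolynomial.eval_X, Matrix.cons_val_zero, Matrix.cons_val_one]
    field_simp
    ring
  rw [WeierstrassCurve.Affine.equation_iff, ← sub_eq_zero, WeierstrassCurve.toAffine, key]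
  simp [hα]

theorem x_pow_three : c.x ^ 3 = algebraMap F c.Cliff c.α := by
  have h := RingQuot.mkAlgHom_rel F (GenCliffordRel.of (Φ := c.Phi) ![1, 0])
  have h' : RingQuot.mkAlgHom F (GenCliffordRel c.Phi)
      (FreeAlgebra.ι F 0 ^ 3 - algebraMap F (FreeAlgebra F (Fin 2)) c.α) = 0 := by
    rw [← map_zero (RingQuot.mkAlgHom F (GenCliffordRel c.Phi)), ← h]
    simp [Phi]
  rw [map_sub, map_pow, AlgHom.commutes, sub_eq_zero] at h'
  exact h'

theorem x_mul_xInv (hα : c.α ≠ 0) : c.x * c.xInv = 1 := by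
  rw [xInv, mul_smul_comm, ← pow_succ', x_pow_three, Algebra.smul_def, ← map_mul,
    inv_mul_cancel₀ hα, map_one]

theorem xInv_mul_x (hα : c.α ≠ 0) : c.xInv * c.x = 1 := by
  rw [xInv, smul_mul_assoc, ← pow_succ, x_pow_three, Algebra.smul_def, ← map_mul,
    inv_mul_cancel₀ hα, map_one]

theorem yComp_sum {ρ : F} (hρ : IsPrimitiveRoot ρ 3) (h3 : (3 : F) ≠ 0) :
    c.y = c.yComp ρ 0 + c.yComp ρ 1 + c.yComp ρ 2 := by
  have h0 : 1 + ρ + ρ ^ 2 = 0 := by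
    simpa [Finset.sum_range_succ] using hρ.geom_sum_eq_zero (by norm_num)
  have h1 : ρ ^ 3 = 1 := hρ.pow_eq_one
  have h4 : ρ ^ 4 = ρ := by rw [pow_succ, h1, one_mul]
  simp only [yComp]
  generalize c.x * c.y * c.xInv = a
  generalize c.x ^ 2 * c.y * c.xInv ^ 2 = b
  have h5 : 1 + ρ ^ 2 + ρ ^ 4 = 0 := by rw [h4]; linear_combination h0
  simp only [pow_zero, pow_one, mul_zero, mul_one, one_smul, Nat.reduceMul]
  have : (3 : F)⁻¹ • (c.y + a + b) + (3 : F)⁻¹ • (c.y + ρ • a + ρ ^ 2 • b)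
      + (3 : F)⁻¹ • (c.y + ρ ^ 2 • a + ρ ^ 4 • b)
      = ((3 : F)⁻¹ * 3) • c.y + ((3 : F)⁻¹ * (1 + ρ + ρ ^ 2)) • a
        + ((3 : F)⁻¹ * (1 + ρ ^ 2 + ρ ^ 4)) • b := by module
  rw [this, h0, h5, inv_mul_cancel₀ h3]
  simp

theorem yComp_mul_x {ρ : F} (hα : c.α ≠ 0) (hρ : ρ ^ 3 = 1) (k : ℕ) :
    c.yComp ρ k * c.x = ρ ^ k • (c.x * c.yComp ρ k) := by
  have h1 := c.xInv_mul_x hα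
  have h2 : c.x ^ 3 * c.y * c.xInv ^ 3 * c.x = c.y * c.x := by
    have hi : c.xInv ^ 3 * c.x ^ 3 = 1 := by
      have hc : Commute c.xInv c.x := by rw [Commute, SemiconjBy, h1, x_mul_xInv _ hα]
      rw [← hc.mul_pow, h1, one_pow]
    rw [x_pow_three] at hi ⊢
    rw [Algebra.commutes c.α c.y, mul_assoc c.y, Algebra.commutes c.α (c.xInv ^ 3), hi, mul_one]
  have e1 : c.x * c.y * c.xInv * c.x = c.x * c.y := by rw [mul_assoc, h1, mul_one]
  have e2 : c.x ^ 2 * c.y * c.xInv ^ 2 * c.x = c.x * (c.x * c.y * c.xInv) := by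
    rw [pow_two c.xInv]
    simp only [mul_assoc, h1, mul_one, pow_two]
  have e3 : c.x * (c.x ^ 2 * c.y * c.xInv ^ 2) = c.y * c.x := by
    rw [← h2, pow_succ c.xInv 2, pow_succ' c.x 2]
    simp only [mul_assoc, h1, mul_one]
  have h3 : ρ ^ k * ρ ^ (2 * k) = 1 := by
    rw [← pow_add, show k + 2 * k = 3 * k by ring, pow_mul, hρ, one_pow]
  simp only [yComp, smul_mul_assoc, mul_smul_comm, add_mul, mul_add, e1, e2, e3, smul_add,
    smul_smul]
  rw [show ρ ^ k * ((3 : F)⁻¹ * ρ ^ (2 * k)) = (3 : F)⁻¹ by rw [mul_left_comm, h3, mul_one],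
    show ρ ^ k * ((3 : F)⁻¹ * ρ ^ k) = (3 : F)⁻¹ * ρ ^ (2 * k) by ring,
    mul_comm (ρ ^ k) (3 : F)⁻¹]
  abel

end CubicCoeffs

/-!
Write `A = C_Φ` and let `R` be a commutative `F`-algebra acting centrally on `A` (either the center
or `F[E]`). The ring `K = R[T]/(T³ - α)` acts on `A` on the left, `T` acting as `x`, and carries the
automorphism `σ : T ↦ ρT`. Conjugation by `x` grades `A` by its three characters: `A₀ = K·1`, `A₁`
contains `y₁` and `y₂²`, and `A₂` contains `y₂` and `y₁²`, where `u k = σ(k) u` for `u ∈ A₁` and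
`u k = σ²(k) u` for `u ∈ A₂`.

*The center contains `F[w, y₁³]`.* The relation of degree one in `y` says that
`y₀ = (r + e x⁻¹ + β x⁻²) / 3`. Substituting `y = y₀ + y₁ + y₂` into the relation of degree two
gives a commutation rule `y₁y₂ = ρ y₂y₁ + k` with an explicit `k ∈ K` (`y₁_mul_y₂`), and this rule
makes `w` and `y₁³` central (`y₁_mul_w`, `y₂_mul_w`, `y₁_pow_three_mul_y₂`). The relation of degree
three becomes `y₁³ + y₂³ = ρ²e w - D`. By the definition of `w`, the product `y₂y₁` is an element of
`K` that is affine linear in `w`, so `y₂³y₁³` is its norm, a cubic polynomial in `w`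
(`y₂_pow_three_mul_y₁_pow_three`). Eliminating `y₂³` leaves the equation of `E` (`curve_equation`).

*Nothing else is central, and `A` is Azumaya.* The discriminant is nonzero, so the two partial
derivatives of the equation of `E` generate the unit ideal (`exists_smooth`). They lie in `A₁A₂` and
in `A₂A₁`: one is `y₁³ - y₂³`, and the other combines `y₁³` with the derivative of the norm above.
Hence `1 ∈ A₁A₂ ∩ A₂A₁`, that is, the grading is strong (`exists_strong_grading`). If
`1 = ∑ u_j v_j` with `u_j ∈ A₁` and `v_j ∈ A₂`, then `∑ u_j k v_j = σ(k)` for `k ∈ K`. A central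
element lies in `A₀` and is therefore fixed by `σ`, so it comes from `R` (`exists_algebraMap_eq`).
The projection to `A₀` followed by the trace of `K` over `R` is given by a two-sided multiplication
operator and has dual families, which is enough for `A` to be Azumaya (`IsAzumaya.of_dual_families`,
`IsCyclicCubic.isAzumaya`). The nine products `xⁱ y₁ʲ` are linearly independent over `R` and span
`A` up to multiplication by `y₁³`, so the rank is `9`
(`Module.rankAtStalk_eq_of_linearIndependent`).

*`F[E]` injects.* Over an algebraic closure of the function field of `E` there is a representation
of `C_Φ` by `3 × 3` matrices in which `w` and `y₁³` are the scalars `R` and `S` (`exists_model`).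
Its relations hold by the Cayley–Hamilton theorem, because `Φ(Z, a, b)` is the characteristic
polynomial of the image of `ax + by`. So the homomorphism from `F[E]` to `C_Φ` is injective
(`coordRing_algHom_injective`).
-/

-- The statements about `F`, `R`, `K` and `A` share one list of compatibility instances.
set_option linter.unusedSectionVars false

/-! ### Azumaya algebras from dual families, and ranks over a domain -/

open TensorProduct MulOpposite in
/-- A criterion for Azumaya algebras: there is a "trace" `T : A → R` of the form
`T s = ∑ u_l s v_l` that admits dual families `a`, `b`. Each endomorphism `g` is then the action of
`∑ g(a_i) u_l b_i ⊗ v_l`, and an element `∑ p_k ⊗ q_k` that acts as zero equals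
`∑ p_k T(b_i q_k) ⊗ a_i = ∑ (p_k u_l b_i q_k) v_l ⊗ a_i = 0`. -/
theorem IsAzumaya.of_dual_families {R A ι κ : Type*} [CommRing R] [Ring A] [Algebra R A]
    [FaithfulSMul R A] [Fintype ι] [Fintype κ] (a b : ι → A) (u v : κ → A) (T : A → R)
    (hT : ∀ s, algebraMap R A (T s) = ∑ l, u l * s * v l)
    (hab : ∀ s, ∑ i, T (b i * s) • a i = s) : IsAzumaya R A := by
  have hinj := FaithfulSMul.algebraMap_injective R A
  let T' : A →ₗ[R] R :=
    { toFun := T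
      map_add' := fun s t ↦ hinj (by simp [hT, mul_add, add_mul, Finset.sum_add_distrib])
      map_smul' := fun k s ↦ hinj (by simp [hT, Algebra.smul_def k (_ : A), mul_assoc,
        Algebra.left_comm, Finset.mul_sum]) }
  have hspan : Submodule.span R (Set.range a) = ⊤ := by
    refine eq_top_iff.2 fun s _ ↦ ?_
    rw [← hab s]
    exact Submodule.sum_mem _ fun i _ ↦ Submodule.smul_mem _ _ (Submodule.subset_span ⟨i, rfl⟩)
  have hfin : Module.Finite R A := ⟨hspan ▸ Submodule.fg_span (Set.finite_range a)⟩
  have hproj : Module.Projective R A := by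
    refine Module.Projective.of_split (M := ι → R)
      (LinearMap.pi fun i ↦ T' ∘ₗ LinearMap.mulLeft R (b i)) (Fintype.linearCombination R a) ?_
    ext s
    simpa [Fintype.linearCombination_apply, T'] using hab s
  refine { bij := ⟨?_, fun g ↦ ⟨∑ i, ∑ l, (g (a i) * u l * b i) ⊗ₜ op (v l), ?_⟩⟩ }
  · rw [injective_iff_map_eq_zero]
    intro t ht
    have key (t : A ⊗[R] Aᵐᵒᵖ) :
        ∑ i, (∑ l, AlgHom.mulLeftRight R A t (u l * b i) * v l) ⊗ₜ[R] op (a i) = t := by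
      induction t with
      | zero => simp
      | add t₁ t₂ h₁ h₂ =>
        simp only [map_add, LinearMap.add_apply, add_mul, Finset.sum_add_distrib, add_tmul, h₁, h₂]
      | tmul p q =>
        have h (i : ι) : ∑ l, AlgHom.mulLeftRight R A (p ⊗ₜ q) (u l * b i) * v l =
            T (b i * q.unop) • p := by
          rw [Algebra.smul_def, Algebra.commutes, hT, Finset.mul_sum]
          simp [mul_assoc]
        simp only [h, smul_tmul]
        rw [← tmul_sum]
        simp only [← op_smul, ← Finset.op_sum, hab, op_unop]
    rw [← key t, ht]
    simp
  · ext s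
    conv_rhs => rw [← hab s, map_sum]
    simp only [map_smul, map_sum, LinearMap.sum_apply, AlgHom.mulLeftRight_apply, unop_op]
    refine Finset.sum_congr rfl fun i _ ↦ ?_
    rw [Algebra.smul_def, Algebra.commutes, hT, Finset.mul_sum]
    simp [mul_assoc]

/-- A finite module over a domain that contains a linearly independent family spanning it up to
multiplication by a nonzero scalar has the size of that family as its rank at every prime. -/
theorem Module.rankAtStalk_eq_of_linearIndependent {R M ι : Type*} [CommRing R] [IsDomain R]
    [AddCommGroup M] [Module R M] [Module.Finite R M] [Fintype ι] {e : ι → M}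
    (he : LinearIndependent R e) {s : R} (hs : s ≠ 0)
    (hspan : ∀ m : M, s • m ∈ Submodule.span R (Set.range e)) (p : PrimeSpectrum R) :
    Module.rankAtStalk (R := R) M p = Fintype.card ι := by
  have h1 : Module.finrank R (M ⧸ Submodule.span R (Set.range e)) = 0 := by
    refine Module.IsTorsion.finrank_eq_zero ?_
    intro m
    induction m using Submodule.Quotient.induction_on with | _ m =>
    refine ⟨⟨s, mem_nonZeroDivisors_of_ne_zero hs⟩, ?_⟩
    exact (Submodule.Quotient.mk_eq_zero _).2 (hspan m)
  -- The quotient by the span of the family is torsion, so both have the same rank.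
  have h2 := Submodule.finrank_quotient_add_finrank (Submodule.span R (Set.range e))
  rw [h1, zero_add, finrank_span_eq_card he] at h2
  rw [h2, Module.rankAtStalk, ← IsLocalizedModule.finrank_eq p.asIdeal.primeCompl
    (LocalizedModule.mkLinearMap p.asIdeal.primeCompl M) p.asIdeal.primeCompl_le_nonZeroDivisors]
  exact IsLocalization.finrank_eq _ p.asIdeal.primeCompl p.asIdeal.primeCompl_le_nonZeroDivisors

namespace CubicCoeffs

section Base

theorem sq_add_self_add_one {F : Type*} [Field F] {ρ : F} (hρ : IsPrimitiveRoot ρ 3) :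
    ρ ^ 2 + ρ + 1 = 0 := by
  have : 1 + ρ + ρ ^ 2 = 0 := by
    simpa [Finset.sum_range_succ] using hρ.geom_sum_eq_zero (by norm_num)
  linear_combination this

theorem algebraMap_inv_three {F K : Type*} [Field F] [CommRing K] [Algebra F K]
    (h3 : (3 : F) ≠ 0) : algebraMap F K 3⁻¹ * 3 = 1 := by
  rw [← map_ofNat (algebraMap F K) 3, ← map_mul, inv_mul_cancel₀ h3, map_one]

theorem algebraMap_inv_eq_pow {F K : Type*} [Field F] [CommRing K] [Algebra F K] {α : F}
    (hα : α ≠ 0) {z : K} (hz : algebraMap F K α * z ^ 3 = 1) : algebraMap F K α⁻¹ = z ^ 3 := by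
  rw [← one_mul (algebraMap F K α⁻¹), ← hz, mul_right_comm, ← map_mul, mul_inv_cancel₀ hα,
    map_one, one_mul]

end Base

/-! ### Relations between the components of `y` -/

section Relations

variable {F K A : Type*} [Field F] [CommRing K] [Algebra F K] [Ring A] [Algebra F A] [Module K A]
  [IsScalarTower F K A] [IsScalarTower K A A] (c : CubicCoeffs F)

/-- `y₀ = (r + e x⁻¹ + β x⁻²) / 3` as a function of `z = x⁻¹`. -/
def y₀Coeff (z : K) : K :=
  algebraMap F K 3⁻¹ * (algebraMap F K c.r + algebraMap F K c.e * z + algebraMap F K c.β * z ^ 2)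

/-- The value of `y₁y₂ - ρ y₂y₁` as a function of `z = x⁻¹`. -/
def commCoeff (ρ : F) (z : K) : K :=
  algebraMap F K 3⁻¹ * (2 + algebraMap F K ρ ^ 2) *
    (algebraMap F K c.D₁ * z - algebraMap F K 3⁻¹ * algebraMap F K c.D₂ * z ^ 3)

/-- The value of `w - x⁻¹y₂y₁` as a function of `z = x⁻¹`. -/
def wCoeff (ρ : F) (z : K) : K :=
  algebraMap F K 3⁻¹ * algebraMap F K ρ ^ 2 * algebraMap F K c.D₁ * z ^ 2
    + algebraMap F K 3⁻¹ ^ 2 * algebraMap F K c.D₂ * z ^ 4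

/-- `D₁` in `K`, with `z³ = x⁻³` in place of `α⁻¹`: this clears denominators, so that identities in
`K` become polynomial identities modulo `α z³ = 1`, `ρ² + ρ + 1 = 0` and `3⁻¹ · 3 = 1`. -/
theorem algebraMap_D₁ (hα : c.α ≠ 0) {z : K} (hz : algebraMap F K c.α * z ^ 3 = 1) :
    algebraMap F K c.D₁ = algebraMap F K c.γ + algebraMap F K 3⁻¹ * algebraMap F K c.e *
      algebraMap F K c.r - algebraMap F K 3⁻¹ * algebraMap F K c.β ^ 2 * z ^ 3 := by
  have hz' := (algebraMap_inv_eq_pow hα hz).symm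
  rw [hz']
  simp only [← map_pow, ← map_mul, ← map_add, ← map_sub]
  congr 1
  simp only [D₁]; field

theorem algebraMap_D₂ :
    algebraMap F K c.D₂ = algebraMap F K c.e * algebraMap F K c.β - 3 * algebraMap F K c.α *
      algebraMap F K c.t - algebraMap F K c.α * algebraMap F K c.r ^ 2 := by
  simp only [D₂, map_sub, map_mul, map_pow, map_ofNat]

theorem algebraMap_D (hα : c.α ≠ 0) {z : K} (hz : algebraMap F K c.α * z ^ 3 = 1) :
    algebraMap F K c.D = algebraMap F K 3⁻¹ ^ 3 * (algebraMap F K c.e ^ 3 * z ^ 3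
      + algebraMap F K c.β ^ 3 * z ^ 6 - 2 * algebraMap F K c.r ^ 3)
      + algebraMap F K 3⁻¹ * algebraMap F K c.β * algebraMap F K c.D₁ * z ^ 3
      - algebraMap F K 3⁻¹ * algebraMap F K c.r * algebraMap F K c.t - algebraMap F K c.δ := by
  have hz' := (algebraMap_inv_eq_pow hα hz).symm
  rw [show z ^ 6 = (z ^ 3) ^ 2 by ring, hz']
  simp only [← map_pow, ← map_mul, ← map_add, ← map_sub, ← map_ofNat (algebraMap F K) 2]
  congr 1
  by_cases h3 : (3 : F) = 0
  · -- If `3 = 0`, every term but `δ` has a vanishing denominator.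
    simp [D, show (27 : F) = 3 * 9 by norm_num, h3]
  · have h27 : (27 : F) ≠ 0 := by
      rw [show (27 : F) = 3 ^ 3 by norm_num]; exact pow_ne_zero _ h3
    simp only [D]; field_simp; ring

/-- The relation of degree `2` in `y` lies in `K y₂y₁ + K y₁y₂ + K` up to components of nonzero
weight, which cancel. The commutation rule results on dividing by `(2 + ρ) x`, which is a unit
because `(2 + ρ)(2 + ρ²) = 3`. -/
theorem y₁_mul_y₂ {ρ : F} {σ : K →ₐ[F] K} {z : K} {y₁ y₂ : A} (h3 : (3 : F) ≠ 0) (hα : c.α ≠ 0)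
    (hρ : ρ ^ 2 + ρ + 1 = 0) (hz : algebraMap F K c.α * z ^ 3 = 1)
    (hσ : σ z = algebraMap F K ρ ^ 2 * z)
    (h1 : ∀ (k : K) (a : A), y₁ * k • a = σ k • (y₁ * a))
    (h2 : ∀ (k : K) (a : A), y₂ * k • a = σ (σ k) • (y₂ * a))
    {x y : A} (hx : x = (algebraMap F K c.α * z ^ 2) • (1 : A))
    (hy : y = c.y₀Coeff z • (1 : A) + y₁ + y₂)
    (hrel : x * y * y + y * x * y + y * y * x - c.r • (x * y + y * x) - c.e • y - c.t • x
      - c.γ • 1 = 0) :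
    y₁ * y₂ = ρ • (y₂ * y₁) + c.commCoeff ρ z • (1 : A) := by
  have hi := algebraMap_inv_three (K := K) h3
  have hρ' : algebraMap F K ρ ^ 2 + algebraMap F K ρ + 1 = 0 := by
    simpa using congrArg (algebraMap F K) hρ
  have hs (k : F) (a : A) : k • a = algebraMap F K k • a := (algebraMap_smul K k a).symm
  have key : x * y * y + y * x * y + y * y * x - c.r • (x * y + y * x) - c.e • y - c.t • x
      - c.γ • 1 = (algebraMap F K (2 + ρ) * (algebraMap F K c.α * z ^ 2)) •
        (y₁ * y₂ - ρ • (y₂ * y₁) - c.commCoeff ρ z • (1 : A)) := by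
    simp only [hs, hx, hy]
    simp only [add_mul, mul_add, smul_mul_assoc, h1, h2, one_mul, mul_one, smul_add, smul_smul,
      mul_assoc]
    simp only [y₀Coeff, commCoeff, map_mul, map_add, map_pow, map_ofNat, AlgHom.commutes, hσ,
      algebraMap_D₁ c hα hz, algebraMap_D₂]
    clear h1 h2 hs hx hy hrel hσ
    generalize algebraMap F K 3⁻¹ = i at *
    match_scalars <;> grind
  rw [hrel] at key
  have hu : z * (algebraMap F K 3⁻¹ * (2 + algebraMap F K ρ ^ 2)) *
      (algebraMap F K (2 + ρ) * (algebraMap F K c.α * z ^ 2)) = 1 := by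
    rw [map_add, map_ofNat]
    grind
  have := congrArg ((z * (algebraMap F K 3⁻¹ * (2 + algebraMap F K ρ ^ 2))) • ·) key
  simp only [smul_zero, smul_smul, hu, one_smul] at this
  rw [← sub_eq_zero, ← sub_sub, ← this]

section Commutation

variable {c} {ρ : F} {σ : K →ₐ[F] K} {z : K} {y₁ y₂ : A}

theorem y₁_mul_w (h3 : (3 : F) ≠ 0) (hρ : ρ ^ 2 + ρ + 1 = 0)
    (hσ : σ z = algebraMap F K ρ ^ 2 * z)
    (h1 : ∀ (k : K) (a : A), y₁ * k • a = σ k • (y₁ * a))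
    (hc : y₁ * y₂ = ρ • (y₂ * y₁) + c.commCoeff ρ z • (1 : A)) :
    y₁ * (z • (y₂ * y₁) + c.wCoeff ρ z • (1 : A)) =
      (z • (y₂ * y₁) + c.wCoeff ρ z • (1 : A)) * y₁ := by
  have hi := algebraMap_inv_three (K := K) h3
  have hρ' : algebraMap F K ρ ^ 2 + algebraMap F K ρ + 1 = 0 := by
    simpa using congrArg (algebraMap F K) hρ
  have hs (k : F) (a : A) : k • a = algebraMap F K k • a := (algebraMap_smul K k a).symm
  have hc' (a : A) : y₁ * (y₂ * a) = ρ • (y₂ * (y₁ * a)) + c.commCoeff ρ z • a := by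
    rw [← mul_assoc, hc]; simp [add_mul, mul_assoc]
  simp only [hs] at hc'
  simp only [add_mul, mul_add, smul_mul_assoc, h1, hc', one_mul, mul_one, smul_add, smul_smul,
      mul_assoc]
  simp only [wCoeff, commCoeff, map_mul, map_add, map_pow, AlgHom.commutes, hσ]
  generalize algebraMap F K 3⁻¹ = i at *
  clear h1 hs hc hc' hσ
  match_scalars <;> grind

theorem y₂_mul_w (h3 : (3 : F) ≠ 0) (hρ : ρ ^ 2 + ρ + 1 = 0)
    (hσ : σ z = algebraMap F K ρ ^ 2 * z)
    (h2 : ∀ (k : K) (a : A), y₂ * k • a = σ (σ k) • (y₂ * a))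
    (hc : y₁ * y₂ = ρ • (y₂ * y₁) + c.commCoeff ρ z • (1 : A)) :
    y₂ * (z • (y₂ * y₁) + c.wCoeff ρ z • (1 : A)) =
      (z • (y₂ * y₁) + c.wCoeff ρ z • (1 : A)) * y₂ := by
  have hi := algebraMap_inv_three (K := K) h3
  have hρ' : algebraMap F K ρ ^ 2 + algebraMap F K ρ + 1 = 0 := by
    simpa using congrArg (algebraMap F K) hρ
  have hs (k : F) (a : A) : k • a = algebraMap F K k • a := (algebraMap_smul K k a).symm
  simp only [hs] at hc
  simp only [add_mul, mul_add, smul_mul_assoc, h2, hc, one_mul, mul_one, smul_add, smul_smul,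
      mul_assoc]
  simp only [wCoeff, commCoeff, map_mul, map_sub, map_add, map_pow, AlgHom.commutes, hσ, map_ofNat]
  generalize algebraMap F K 3⁻¹ = i at *
  clear h2 hs hc hσ
  match_scalars <;> grind

theorem y₁_pow_three_mul_y₂ (h3 : (3 : F) ≠ 0) (hρ : ρ ^ 2 + ρ + 1 = 0)
    (hσ : σ z = algebraMap F K ρ ^ 2 * z)
    (h1 : ∀ (k : K) (a : A), y₁ * k • a = σ k • (y₁ * a))
    (hc : y₁ * y₂ = ρ • (y₂ * y₁) + c.commCoeff ρ z • (1 : A)) :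
    y₁ ^ 3 * y₂ = y₂ * y₁ ^ 3 := by
  have hi := algebraMap_inv_three (K := K) h3
  have hρ' : algebraMap F K ρ ^ 2 + algebraMap F K ρ + 1 = 0 := by
    simpa using congrArg (algebraMap F K) hρ
  have hs (k : F) (a : A) : k • a = algebraMap F K k • a := (algebraMap_smul K k a).symm
  have hc' (a : A) : y₁ * (y₂ * a) = ρ • (y₂ * (y₁ * a)) + c.commCoeff ρ z • a := by
    rw [← mul_assoc, hc]; simp [add_mul, mul_assoc]
  simp only [hs] at hc' hc
  simp only [pow_succ, pow_zero, mul_add, h1, hc, hc', one_mul, mul_one, smul_add, smul_smul,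
      mul_assoc]
  simp only [commCoeff, map_mul, map_sub, map_add, map_pow, AlgHom.commutes, hσ, map_ofNat]
  generalize algebraMap F K 3⁻¹ = i at *
  clear h1 hs hc hc' hσ
  match_scalars <;> grind

/-- The weight zero part of the relation of degree `3` in `y`. -/
theorem y₁_pow_three_add_y₂_pow_three (h3 : (3 : F) ≠ 0) (hα : c.α ≠ 0)
    (hρ : ρ ^ 2 + ρ + 1 = 0) (hz : algebraMap F K c.α * z ^ 3 = 1)
    (hσ : σ z = algebraMap F K ρ ^ 2 * z)
    (h1 : ∀ (k : K) (a : A), y₁ * k • a = σ k • (y₁ * a))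
    (h2 : ∀ (k : K) (a : A), y₂ * k • a = σ (σ k) • (y₂ * a))
    (hc : y₁ * y₂ = ρ • (y₂ * y₁) + c.commCoeff ρ z • (1 : A))
    {y : A}  (hy : y = c.y₀Coeff z • (1 : A) + y₁ + y₂)
    (hrel : y ^ 3 - c.r • y ^ 2 - c.t • y - c.δ • 1 = 0) :
    y₁ ^ 3 + y₂ ^ 3 =
      (ρ ^ 2 * c.e) • (z • (y₂ * y₁) + c.wCoeff ρ z • (1 : A)) - c.D • (1 : A) := by
  have hi := algebraMap_inv_three (K := K) h3
  have hρ' : algebraMap F K ρ ^ 2 + algebraMap F K ρ + 1 = 0 := by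
    simpa using congrArg (algebraMap F K) hρ
  have hs (k : F) (a : A) : k • a = algebraMap F K k • a := (algebraMap_smul K k a).symm
  have hc' (a : A) : y₁ * (y₂ * a) = ρ • (y₂ * (y₁ * a)) + c.commCoeff ρ z • a := by
    rw [← mul_assoc, hc]; simp [add_mul, mul_assoc]
  rw [← sub_eq_zero, ← hrel]
  simp only [hs] at hc' hc
  simp only [hs, hy, pow_succ, pow_zero, add_mul, mul_add, smul_mul_assoc, h1, h2, hc, hc',
    one_mul, mul_one, smul_add, smul_smul, mul_assoc]
  simp only [wCoeff, commCoeff, y₀Coeff, map_mul, map_sub, map_add, map_pow, map_ofNat,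
    AlgHom.commutes, hσ, algebraMap_D c hα hz, algebraMap_D₁ c hα hz, algebraMap_D₂]
  generalize algebraMap F K 3⁻¹ = i at *
  clear h1 h2 hs hc hc' hσ hy hrel
  match_scalars <;> grind

/-- Multiplication by `x` turns `w` back into `y₂y₁`. -/
theorem y₂_mul_y₁ (hz : algebraMap F K c.α * z ^ 3 = 1) {W : K}
    (hW : W • (1 : A) = z • (y₂ * y₁) + c.wCoeff ρ z • (1 : A)) :
    y₂ * y₁ = (algebraMap F K c.α * z ^ 2 * (W - c.wCoeff ρ z)) • (1 : A) := by
  rw [mul_smul, sub_smul, hW, add_sub_cancel_right, smul_smul, mul_assoc, ← pow_succ, hz, one_smul]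

/-- The norm of `y₂y₁`: `y₂³y₁³` is a cubic polynomial in `w`. -/
theorem y₂_pow_three_mul_y₁_pow_three (h3 : (3 : F) ≠ 0) (hα : c.α ≠ 0)
    (hρ : ρ ^ 2 + ρ + 1 = 0) (hz : algebraMap F K c.α * z ^ 3 = 1)
    (hσ : σ z = algebraMap F K ρ ^ 2 * z)
    (h2 : ∀ (k : K) (a : A), y₂ * k • a = σ (σ k) • (y₂ * a)) {W : K} (hσW : σ W = W)
    (hW : W • (1 : A) = z • (y₂ * y₁) + c.wCoeff ρ z • (1 : A)) :
    y₂ ^ 3 * y₁ ^ 3 = (algebraMap F K c.α * W ^ 3 - algebraMap F K (c.D₁ ^ 3 / (27 * c.α))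
      - algebraMap F K (c.D₂ ^ 3 / (729 * c.α ^ 3))
      - algebraMap F K (ρ ^ 2 * (c.D₁ * c.D₂ / (9 * c.α))) * W) • (1 : A) := by
  have hi := algebraMap_inv_three (K := K) h3
  have hρ' : algebraMap F K ρ ^ 2 + algebraMap F K ρ + 1 = 0 := by
    simpa using congrArg (algebraMap F K) hρ
  have hz' := algebraMap_inv_eq_pow hα hz
  have e1 : c.D₁ ^ 3 / (27 * c.α) = 3⁻¹ ^ 3 * c.D₁ ^ 3 * c.α⁻¹ := by
    rw [show (27 : F) = 3 ^ 3 by norm_num]; field_simp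
  have e2 : c.D₂ ^ 3 / (729 * c.α ^ 3) = 3⁻¹ ^ 6 * c.D₂ ^ 3 * c.α⁻¹ ^ 3 := by
    rw [show (729 : F) = 3 ^ 6 by norm_num]; field_simp
  have e3 : c.D₁ * c.D₂ / (9 * c.α) = 3⁻¹ ^ 2 * c.D₁ * c.D₂ * c.α⁻¹ := by
    rw [show (9 : F) = 3 ^ 2 by norm_num]; field_simp
  have hc := y₂_mul_y₁ hz hW
  have hc' (a : A) : y₂ * (y₁ * a) = (algebraMap F K c.α * z ^ 2 * (W - c.wCoeff ρ z)) • a := by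
    rw [← mul_assoc, hc, smul_mul_assoc, one_mul]
  simp only [pow_succ y₁, pow_succ y₂, pow_zero, h2, hc, hc', one_mul, smul_smul, mul_assoc]
  congr 1
  rw [e1, e2, e3]
  simp only [wCoeff, map_mul, map_sub, map_add, map_pow, AlgHom.commutes, hσ, hz', hσW]
  clear h2 hc hc' hσ hW hσW e1 e2 e3 hz'
  generalize algebraMap F K 3⁻¹ = i at *
  generalize algebraMap F K c.α = α at *
  grind

end Commutation

end Relations

/-! ### The Kummer extension generated by `x` -/

section Twist

universe u

open Polynomial

/-- The ring `K = R[T]/(T³ - α)`, where `T` acts on `A` as multiplication by `x`, with the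
automorphism `σ : T ↦ ρT`. It is described by the generator `z = T⁻¹ = α⁻¹T²`, so that `T = αz²`.
Since `x` need not be central, `A` is only a left `K`-module here, and not a `K`-algebra. -/
theorem exists_kummer {F : Type*} {R : Type u} {A : Type*} [Field F] [CommRing R] [Ring A]
    [Algebra F R] [Algebra F A] [Algebra R A] [IsScalarTower F R A] {α ρ : F}
    (hα : α ≠ 0) (hρ : ρ ^ 3 = 1) {x : A} (hx : x ^ 3 = algebraMap F A α) :
    ∃ (K : Type u) (_ : CommRing K) (_ : Algebra F K) (_ : Algebra R K) (_ : IsScalarTower F R K)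
      (_ : Module K A) (_ : IsScalarTower F K A) (_ : IsScalarTower R K A)
      (_ : IsScalarTower K A A) (σ : K →ₐ[R] K) (z : K),
      algebraMap F K α * z ^ 3 = 1 ∧ σ z = algebraMap F K ρ ^ 2 * z ∧
      (∀ k : K, ∃ r₀ r₁ r₂ : R, k = algebraMap R K r₀ + algebraMap R K r₁ * z
        + algebraMap R K r₂ * z ^ 2) ∧
      ∀ a : A, (algebraMap F K α * z ^ 2) • a = x * a := by
  let f : R[X] := X ^ 3 - C (algebraMap F R α)
  let ι : AdjoinRoot f →ₐ[R] A := Ideal.Quotient.liftₐ (Ideal.span {f}) (aeval x) (by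
    intro p hp
    obtain ⟨q, rfl⟩ := Ideal.mem_span_singleton'.1 hp
    simp [f, hx, ← IsScalarTower.algebraMap_apply])
  have hι : ι (AdjoinRoot.root f) = x := by
    change aeval x (X : R[X]) = x
    simp
  have hroot : AdjoinRoot.root f ^ 3 = algebraMap F (AdjoinRoot f) α := by
    have := AdjoinRoot.eval₂_root f
    rw [eval₂_sub, eval₂_pow, eval₂_X, eval₂_C, sub_eq_zero] at this
    rw [this, IsScalarTower.algebraMap_apply F R (AdjoinRoot f)]
    rfl
  let _ : Module (AdjoinRoot f) A := Module.compHom A ι.toRingHom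
  have hsmul (k : AdjoinRoot f) (a : A) : k • a = ι k * a := rfl
  have hρ' : algebraMap F (AdjoinRoot f) ρ ^ 3 = 1 := by rw [← map_pow, hρ, map_one]
  have hf : aeval (algebraMap F (AdjoinRoot f) ρ * AdjoinRoot.root f) f = 0 := by
    rw [map_sub, map_pow, aeval_X, aeval_C, mul_pow, hρ', hroot, one_mul,
      ← IsScalarTower.algebraMap_apply, sub_self]
  let σ : AdjoinRoot f →ₐ[R] AdjoinRoot f := Ideal.Quotient.liftₐ (Ideal.span {f})
    (aeval (algebraMap F (AdjoinRoot f) ρ * AdjoinRoot.root f)) (by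
    intro p hp
    obtain ⟨q, rfl⟩ := Ideal.mem_span_singleton'.1 hp
    rw [map_mul, hf, mul_zero])
  have hσ : σ (AdjoinRoot.root f) = algebraMap F (AdjoinRoot f) ρ * AdjoinRoot.root f := by
    change aeval _ (X : R[X]) = _
    simp
  have hαα : algebraMap F (AdjoinRoot f) α * algebraMap F (AdjoinRoot f) α⁻¹ = 1 := by
    rw [← map_mul, mul_inv_cancel₀ hα, map_one]
  have hσF (k : F) : σ (algebraMap F _ k) = algebraMap F _ k := by
    rw [IsScalarTower.algebraMap_apply F R, AlgHom.commutes]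
  refine ⟨AdjoinRoot f, inferInstance, inferInstance, inferInstance, inferInstance, inferInstance,
    ⟨fun a b c ↦ ?_⟩, ⟨fun a b c ↦ ?_⟩, ⟨fun a b c ↦ ?_⟩, σ,
    algebraMap F _ α⁻¹ * AdjoinRoot.root f ^ 2, ?_, ?_, ?_, ?_⟩
  · rw [hsmul, hsmul, ← algebraMap_smul R, map_smul, smul_mul_assoc, algebraMap_smul]
  · rw [hsmul, hsmul, map_smul, smul_mul_assoc]
  · rw [hsmul, hsmul, smul_eq_mul, smul_eq_mul, mul_assoc]
  · linear_combination (algebraMap F (AdjoinRoot f) α * algebraMap F (AdjoinRoot f) α⁻¹ ^ 3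
      * (AdjoinRoot.root f ^ 3 + algebraMap F _ α)) * hroot
      + (1 + algebraMap F (AdjoinRoot f) α * algebraMap F (AdjoinRoot f) α⁻¹
        + (algebraMap F (AdjoinRoot f) α * algebraMap F (AdjoinRoot f) α⁻¹) ^ 2) * hαα
  · rw [map_mul, map_pow, hσ, hσF]
    ring
  · have hmain (p : R[X]) : ∃ r₀ r₁ r₂ : R, AdjoinRoot.mk f p = algebraMap R _ r₀
        + algebraMap R _ r₁ * (algebraMap F _ α⁻¹ * AdjoinRoot.root f ^ 2)
        + algebraMap R _ r₂ * (algebraMap F _ α⁻¹ * AdjoinRoot.root f ^ 2) ^ 2 := by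
      induction p using Polynomial.induction_on' with
      | add p q hp hq =>
        obtain ⟨a, b, c, h⟩ := hp
        obtain ⟨a', b', c', h'⟩ := hq
        refine ⟨a + a', b + b', c + c', ?_⟩
        rw [map_add, h, h']
        simp only [map_add]
        ring
      | monomial n r =>
        induction n with
        | zero => exact ⟨r, 0, 0, by simp⟩
        | succ n ih =>
          obtain ⟨a, b, c, h⟩ := ih
          refine ⟨b, c, algebraMap F R α * a, ?_⟩
          rw [← monomial_mul_X, map_mul, h, AdjoinRoot.mk_X]
          simp only [map_mul, ← IsScalarTower.algebraMap_apply]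
          linear_combination (algebraMap R _ b * algebraMap F _ α⁻¹
            + algebraMap R _ c * algebraMap F _ α⁻¹ ^ 2 * AdjoinRoot.root f ^ 2
            - algebraMap R _ a * algebraMap F _ α * algebraMap F _ α⁻¹ ^ 2 * AdjoinRoot.root f)
            * hroot + (algebraMap R _ b
            + algebraMap R _ c * algebraMap F _ α⁻¹ * AdjoinRoot.root f ^ 2
            - algebraMap R _ a * AdjoinRoot.root f * (algebraMap F _ α * algebraMap F _ α⁻¹ + 1))
            * hαα
    intro k
    obtain ⟨p, rfl⟩ := AdjoinRoot.mk_surjective k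
    exact hmain p
  · intro a
    have : algebraMap F (AdjoinRoot f) α *
        (algebraMap F (AdjoinRoot f) α⁻¹ * AdjoinRoot.root f ^ 2) ^ 2 = AdjoinRoot.root f := by
      linear_combination
        algebraMap F _ α * algebraMap F _ α⁻¹ ^ 2 * AdjoinRoot.root f * hroot
        + AdjoinRoot.root f * (algebraMap F _ α * algebraMap F _ α⁻¹ + 1) * hαα
    rw [this, hsmul, hι]

end Twist

/-! ### Algebras graded by the characters of a cyclic cubic extension -/

/-- `u` is semilinear with respect to `τ` under left multiplication: `u k = τ(k) u` for `k ∈ K`. -/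
def IsTwisted {K A : Type*} [CommRing K] [Ring A] [Module K A] (τ : K → K) (u : A) : Prop :=
  ∀ (k : K) (a : A), u * k • a = τ k • (u * a)

namespace IsTwisted

variable {K A : Type*} [CommRing K] [Ring A] [Module K A]

theorem mul {τ τ' : K → K} {u v : A} (hu : IsTwisted τ u) (hv : IsTwisted τ' v) :
    IsTwisted (τ ∘ τ') (u * v) := fun k a ↦ by
  rw [mul_assoc, hv, hu, mul_assoc, Function.comp_apply]

theorem add {τ : K → K} {u v : A} (hu : IsTwisted τ u) (hv : IsTwisted τ v) :
    IsTwisted τ (u + v) := fun k a ↦ by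
  rw [add_mul, hu, hv, add_mul, smul_add]

theorem congr {τ τ' : K → K} {u : A} (hu : IsTwisted τ u) (h : ∀ k, τ k = τ' k) : IsTwisted τ' u :=
  fun k a ↦ by rw [hu, h]

theorem smul [IsScalarTower K A A] {τ : K → K} {u : A} (k : K) (hu : IsTwisted τ u) :
    IsTwisted τ (k • u) := fun l a ↦ by
  rw [smul_mul_assoc, hu, smul_mul_assoc, smul_smul, smul_smul, mul_comm]

theorem mul_smul_one {τ : K → K} {u : A} (hu : IsTwisted τ u) (k : K) :
    u * k • (1 : A) = τ k • u := by
  rw [hu, mul_one]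

end IsTwisted

section Graded

variable {F R K A : Type*} [Field F] [CommRing R] [CommRing K] [Ring A] [Algebra F R]
  [Algebra F K] [Algebra F A] [Algebra R K] [IsScalarTower F R K] [Algebra R A] [Module K A]
  [IsScalarTower F K A] [IsScalarTower R K A] [IsScalarTower K A A]
  {α ρ : F} {σ : K →ₐ[R] K} {z : K}

/-- `K` is generated over `R` by `z`, and `z` acts on `A` as the inverse of a cube root `x` of `α`;
the automorphism `σ` of `K` is `x ↦ ρ x`. -/
structure IsCyclicCubic (α ρ : F) (σ : K →ₐ[R] K) (z : K) (x : A) : Prop where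
  root : algebraMap F K α * z ^ 3 = 1
  map_root : σ z = algebraMap F K ρ ^ 2 * z
  exists_repr : ∀ k : K, ∃ r₀ r₁ r₂ : R, k = algebraMap R K r₀ + algebraMap R K r₁ * z
    + algebraMap R K r₂ * z ^ 2
  smul_eq : ∀ a : A, (algebraMap F K α * z ^ 2) • a = x * a

/-- An element that commutes with `x` up to the scalar `ω` is twisted by `x ↦ ωx`. -/
theorem IsTwisted.of_mul_eq (hα : α ≠ 0) (hz : algebraMap F K α * z ^ 3 = 1)
    (hK : ∀ k : K, ∃ r₀ r₁ r₂ : R, k = algebraMap R K r₀ + algebraMap R K r₁ * z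
      + algebraMap R K r₂ * z ^ 2) {x : A} (hx : ∀ a : A, (algebraMap F K α * z ^ 2) • a = x * a)
    {τ : K →ₐ[R] K} {ω : F} (hτ : τ z = algebraMap F K ω ^ 2 * z) {u : A}
    (hu : u * x = ω • (x * u)) : IsTwisted τ u := by
  have h1 (a : A) : u * z • a = τ z • (u * a) := by
    have hz2 : algebraMap F K α * z = (algebraMap F K α * z ^ 2) ^ 2 := by
      linear_combination (-algebraMap F K α * z) * hz
    have hz2' (b : A) : α • z • b = x * (x * b) := by
      rw [← algebraMap_smul K α, smul_smul, hz2, pow_two, mul_smul, hx, hx]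
    have : α • (u * z • a) = α • (τ z • (u * a)) := by
      have hu' (b : A) : u * (x * b) = ω • (x * (u * b)) := by
        rw [← mul_assoc, hu, smul_mul_assoc, mul_assoc]
      rw [← mul_smul_comm, hz2', hu', hu', mul_smul_comm, hτ, mul_smul, smul_comm α, hz2',
        smul_smul, ← pow_two, ← map_pow, algebraMap_smul]
    simpa only [smul_smul, inv_mul_cancel₀ hα, one_smul] using congrArg (α⁻¹ • ·) this
  intro k a
  obtain ⟨r₀, r₁, r₂, rfl⟩ := hK k
  simp only [add_smul, mul_smul, pow_two, map_add, map_mul, AlgHom.commutes, algebraMap_smul,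
    mul_add, mul_smul_comm, h1]

/-- The projection of `A` to the centralizer of `x`: the mean of the conjugates by powers of `x`. -/
def proj (α : F) (z : K) (a : A) : A :=
  (3⁻¹ : F) • (a + (algebraMap F K α * z ^ 2) • (a * z • (1 : A))
    + (algebraMap F K α * z ^ 2) ^ 2 • (a * z ^ 2 • (1 : A)))

theorem proj_add (a b : A) : proj α z (a + b) = proj α z a + proj α z b := by
  simp only [proj, add_mul, smul_add]
  abel

theorem proj_smul (k : K) (a : A) : proj α z (k • a) = k • proj α z a := by
  have hs (k : F) (a : A) : k • a = algebraMap F K k • a := (algebraMap_smul K k a).symm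
  simp only [proj, smul_mul_assoc, smul_add, smul_smul, hs]
  match_scalars <;> ring

theorem proj_eq_self (h3 : (3 : F) ≠ 0) (hz : algebraMap F K α * z ^ 3 = 1) {a : A}
    (ha : IsTwisted (id : K → K) a) : proj (K := K) α z a = a := by
  have h : (algebraMap F K α * z ^ 2) * z = 1 := by linear_combination hz
  rw [proj, ha.mul_smul_one, ha.mul_smul_one, id, id, smul_smul, smul_smul, h, ← mul_pow, h,
    one_pow, one_smul, ← one_smul F a, ← add_smul, ← add_smul, smul_smul]
  norm_num [h3]

theorem isTwisted_smul_one (k : K) : IsTwisted (id : K → K) (k • (1 : A)) := fun l a ↦ by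
  rw [smul_mul_assoc, one_mul, smul_mul_assoc, one_mul, smul_smul, smul_smul, mul_comm, id]

/-- The three conjugates of an element of weight `ω ≠ 1` sum to zero. -/
theorem proj_eq_zero (hz : algebraMap F K α * z ^ 3 = 1) {τ : K → K} {ω : F}
    (hω : ω ^ 4 + ω ^ 2 + 1 = 0) (hτ : τ z = algebraMap F K ω ^ 2 * z)
    (hτ2 : τ (z ^ 2) = τ z ^ 2) {a : A} (ha : IsTwisted τ a) : proj (K := K) α z a = 0 := by
  have hω' : algebraMap F K ω ^ 4 + algebraMap F K ω ^ 2 + 1 = 0 := by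
    simpa using congrArg (algebraMap F K) hω
  rw [proj, ha.mul_smul_one, ha.mul_smul_one, hτ2, hτ, smul_smul, smul_smul, ← one_smul K a,
    smul_smul, smul_smul, ← add_smul, ← add_smul]
  convert smul_zero _
  convert zero_smul K _
  linear_combination
    (algebraMap F K ω ^ 2 + algebraMap F K ω ^ 4 * (algebraMap F K α * z ^ 3 + 1)) * hz + hω'

/-- The trace of `K` over the fixed ring `R` takes values in `R`. -/
theorem exists_trace (hρ : ρ ^ 2 + ρ + 1 = 0) (hσ : σ z = algebraMap F K ρ ^ 2 * z)
    (hK : ∀ k : K, ∃ r₀ r₁ r₂ : R, k = algebraMap R K r₀ + algebraMap R K r₁ * z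
      + algebraMap R K r₂ * z ^ 2) (k : K) :
    ∃ t : R, algebraMap R K t = k + σ k + σ (σ k) := by
  have hρ' : algebraMap F K ρ ^ 2 + algebraMap F K ρ + 1 = 0 := by
    simpa using congrArg (algebraMap F K) hρ
  have hσF (k : F) : σ (algebraMap F K k) = algebraMap F K k :=
    (σ.restrictScalars F).commutes k
  obtain ⟨r₀, r₁, r₂, rfl⟩ := hK k
  refine ⟨3 * r₀, ?_⟩
  simp only [map_add, map_mul, map_pow, AlgHom.commutes, hσ, hσF, map_ofNat]
  generalize algebraMap F K ρ = p at *
  grind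

/-- Expansion with respect to the basis `1, x, x²` of `K`; the dual basis for the trace is
`1/3, x⁻¹/3, x⁻²/3`. -/
theorem sum_trace_eq (hρ : ρ ^ 2 + ρ + 1 = 0) (hz : algebraMap F K α * z ^ 3 = 1)
    (hσ : σ z = algebraMap F K ρ ^ 2 * z) (k : K) :
    ∑ i : Fin 3, (z ^ (i : ℕ) * k + σ (z ^ (i : ℕ) * k) + σ (σ (z ^ (i : ℕ) * k))) *
      (algebraMap F K α * z ^ 2) ^ (i : ℕ) = 3 * k := by
  have hρ' : algebraMap F K ρ ^ 2 + algebraMap F K ρ + 1 = 0 := by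
    simpa using congrArg (algebraMap F K) hρ
  have hσF (k : F) : σ (algebraMap F K k) = algebraMap F K k :=
    (σ.restrictScalars F).commutes k
  simp only [Fin.sum_univ_three, Fin.val_zero, Fin.val_one, Fin.val_two, map_mul, map_pow, hσ, hσF]
  generalize algebraMap F K ρ = p at *
  generalize σ (σ k) = k2 at *
  generalize σ k = k1 at *
  grind

namespace IsCyclicCubic

variable {x : A} (h : IsCyclicCubic α ρ σ z x)
include h

theorem map_map_map (hρ : ρ ^ 3 = 1) (k : K) : σ (σ (σ k)) = k := by
  have hσF (k : F) : σ (algebraMap F K k) = algebraMap F K k :=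
    (σ.restrictScalars F).commutes k
  have hρ' : algebraMap F K ρ ^ 3 = 1 := by rw [← map_pow, hρ, map_one]
  obtain ⟨r₀, r₁, r₂, rfl⟩ := h.exists_repr k
  simp only [map_add, map_mul, map_pow, AlgHom.commutes, h.map_root, hσF]
  generalize algebraMap F K ρ = p at *
  grind

theorem proj_eq_zero_of_twisted (hρ : ρ ^ 2 + ρ + 1 = 0) {a : A} (ha : IsTwisted σ a) :
    proj (K := K) α z a = 0 :=
  proj_eq_zero h.root (by grind) h.map_root (map_pow _ _ _) ha

theorem proj_eq_zero_of_twisted_twice (hρ : ρ ^ 2 + ρ + 1 = 0) {a : A} (ha : IsTwisted (σ ∘ σ) a) :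
    proj (K := K) α z a = 0 := by
  have hσF (k : F) : σ (algebraMap F K k) = algebraMap F K k :=
    (σ.restrictScalars F).commutes k
  refine proj_eq_zero (ω := ρ ^ 2) h.root (by grind) ?_ (by simp) ha
  simp only [Function.comp_apply, h.map_root, map_mul, map_pow, hσF]
  ring

/-- The graded decomposition makes `A` Azumaya as soon as it is strongly graded, that is, as soon as
`1 ∈ A₁A₂` and `1 ∈ A₂A₁`: then `s ↦ ∑ u_j proj(s) v_j` is the reduced trace, and dual families
for it arise from those of `K` and the `u_j`, `v_j`. -/
theorem isAzumaya [FaithfulSMul R A] (h3 : (3 : F) ≠ 0) (hρ : ρ ^ 2 + ρ + 1 = 0)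
    (hdec : ∀ a : A, ∃ (k : K) (a₁ a₂ : A), IsTwisted σ a₁ ∧ IsTwisted (σ ∘ σ) a₂ ∧
      a = k • (1 : A) + a₁ + a₂)
    {J₁ J₂ : Type*} [Fintype J₁] [Fintype J₂] {u₁ v₁ : J₁ → A} {u₂ v₂ : J₂ → A}
    (hu₁ : ∀ j, IsTwisted σ (u₁ j)) (hv₁ : ∀ j, IsTwisted (σ ∘ σ) (v₁ j))
    (hu₂ : ∀ j, IsTwisted (σ ∘ σ) (u₂ j)) (hv₂ : ∀ j, IsTwisted σ (v₂ j))
    (h₁ : ∑ j, u₁ j * v₁ j = 1) (h₂ : ∑ j, u₂ j * v₂ j = 1) : IsAzumaya R A := by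
  have hinj := FaithfulSMul.algebraMap_injective R A
  have hρ3 : ρ ^ 3 = 1 := by grind
  have hσ3 : σ ∘ σ ∘ σ = id := funext fun k ↦ h.map_map_map hρ3 k
  have hσ4 : (σ ∘ σ) ∘ (σ ∘ σ) = σ := funext fun k ↦ h.map_map_map hρ3 (σ k)
  have p0 {a : A} (ha : IsTwisted (id : K → K) a) : proj (K := K) α z a = a :=
    proj_eq_self h3 h.root ha
  have p1 {a : A} (ha : IsTwisted σ a) : proj (K := K) α z a = 0 :=
    h.proj_eq_zero_of_twisted hρ ha
  have p2 {a : A} (ha : IsTwisted (σ ∘ σ) a) : proj (K := K) α z a = 0 :=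
    h.proj_eq_zero_of_twisted_twice hρ ha
  have hproj (a : A) : ∃ k : K, proj (K := K) α z a = k • (1 : A) := by
    obtain ⟨k, a₁, a₂, ha₁, ha₂, rfl⟩ := hdec a
    exact ⟨k, by rw [proj_add, proj_add, p1 ha₁, p2 ha₂, p0 (isTwisted_smul_one k), add_zero,
      add_zero]⟩
  let u : Unit ⊕ J₁ ⊕ J₂ → A := Sum.elim 1 (Sum.elim u₁ u₂)
  let v : Unit ⊕ J₁ ⊕ J₂ → A := Sum.elim 1 (Sum.elim v₁ v₂)
  -- Since `u` and `v` contain a decomposition of `1` in each degree, they turn `k ∈ K` into its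
  -- trace and recover `a` from the degree zero parts of the products `v_j a`.
  have htr (k : K) : ∑ j, u j * k • (1 : A) * v j = (k + σ k + σ (σ k)) • (1 : A) := by
    simp only [u, v, Fintype.sum_sum_type, Sum.elim_inl, Sum.elim_inr, (hu₁ _).mul_smul_one,
      (hu₂ _).mul_smul_one, smul_mul_assoc, ← Finset.smul_sum, h₁, h₂]
    simp [add_smul, add_assoc]
  have hrec (a : A) : ∑ j, u j * proj (K := K) α z (v j * a) = a := by
    obtain ⟨k, a₁, a₂, ha₁, ha₂, rfl⟩ := hdec a
    have e1 (j : J₁) : proj (K := K) α z (v₁ j * (k • (1 : A) + a₁ + a₂)) = v₁ j * a₁ := by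
      rw [mul_add, mul_add, proj_add, proj_add, p2 ((hv₁ j).mul (isTwisted_smul_one k)),
        p0 (by simpa [Function.comp_assoc, hσ3] using (hv₁ j).mul ha₁),
        p1 (by simpa only [hσ4] using (hv₁ j).mul ha₂), zero_add, add_zero]
    have e2 (j : J₂) : proj (K := K) α z (v₂ j * (k • (1 : A) + a₁ + a₂)) = v₂ j * a₂ := by
      rw [mul_add, mul_add, proj_add, proj_add, p1 ((hv₂ j).mul (isTwisted_smul_one k)),
        p2 ((hv₂ j).mul ha₁), p0 (by simpa only [hσ3] using (hv₂ j).mul ha₂), zero_add, zero_add]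
    simp only [u, v, Fintype.sum_sum_type, Sum.elim_inl, Sum.elim_inr, e1, e2, ← mul_assoc,
      ← Finset.sum_mul, h₁, h₂]
    simp [proj_add, p1 ha₁, p2 ha₂, p0 (isTwisted_smul_one k), add_assoc]
  have hT (s : A) : ∃ t : R, algebraMap R A t = ∑ j, u j * proj (K := K) α z s * v j := by
    obtain ⟨k, hk⟩ := hproj s
    obtain ⟨t, ht⟩ := exists_trace hρ h.map_root h.exists_repr k
    exact ⟨t, by rw [hk, htr, ← ht, algebraMap_smul, Algebra.algebraMap_eq_smul_one]⟩
  choose T hT using hT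
  refine IsAzumaya.of_dual_families (ι := (Unit ⊕ J₁ ⊕ J₂) × Fin 3) (κ := (Unit ⊕ J₁ ⊕ J₂) × Fin 3)
    (fun l ↦ (3⁻¹ : F) • (u l.1 * (algebraMap F K α * z ^ 2) ^ (l.2 : ℕ) • (1 : A)))
    (fun l ↦ z ^ (l.2 : ℕ) • v l.1)
    (fun l ↦ (3⁻¹ : F) • (u l.1 * (algebraMap F K α * z ^ 2) ^ (l.2 : ℕ) • (1 : A)))
    (fun l ↦ z ^ (l.2 : ℕ) • v l.1) T (fun s ↦ ?_) fun s ↦ ?_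
  · rw [hT, Fintype.sum_prod_type]
    refine Finset.sum_congr rfl fun j _ ↦ ?_
    have hz1 (k : K) : k • v j = k • (1 : A) * v j := by rw [smul_mul_assoc, one_mul]
    have hz2 (k : K) (a : A) : k • a = k • (1 : A) * a := by rw [smul_mul_assoc, one_mul]
    rw [Fin.sum_univ_three, proj]
    simp only [Fin.val_zero, Fin.val_one, Fin.val_two, pow_zero, pow_one, one_smul]
    rw [hz1 z, hz1 (z ^ 2), hz2 (algebraMap F K α * z ^ 2), hz2 ((algebraMap F K α * z ^ 2) ^ 2)]
    simp only [mul_one, smul_mul_assoc, mul_smul_comm, mul_add, add_mul, mul_assoc, smul_add]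
  · rw [Fintype.sum_prod_type]
    conv_rhs => rw [← hrec s]
    refine Finset.sum_congr rfl fun j _ ↦ ?_
    obtain ⟨k, hk⟩ := hproj (v j * s)
    have ht (i : Fin 3) (m : A) : T (z ^ (i : ℕ) • v j * s) • m =
        (z ^ (i : ℕ) * k + σ (z ^ (i : ℕ) * k) + σ (σ (z ^ (i : ℕ) * k))) • m := by
      obtain ⟨t, ht⟩ := exists_trace hρ h.map_root h.exists_repr (z ^ (i : ℕ) * k)
      have : T (z ^ (i : ℕ) • v j * s) = t := hinj (by
        rw [hT, smul_mul_assoc, proj_smul, hk, smul_smul, htr, ← ht, algebraMap_smul,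
          Algebra.algebraMap_eq_smul_one])
      rw [this, ← ht, algebraMap_smul]
    have ht' (i : Fin 3) (m : K) : T (z ^ (i : ℕ) • v j * s) • (u j * m • (1 : A)) =
        u j * ((z ^ (i : ℕ) * k + σ (z ^ (i : ℕ) * k) + σ (σ (z ^ (i : ℕ) * k))) * m) •
          (1 : A) := by
      rw [← mul_smul_comm, ht, smul_smul]
    simp only [smul_comm _ (3⁻¹ : F), ht']
    rw [← Finset.smul_sum, ← Finset.mul_sum, ← Finset.sum_smul, sum_trace_eq hρ h.root h.map_root,
      hk, ← mul_smul_comm, mul_smul, ofNat_smul_eq_nsmul, ← Nat.cast_smul_eq_nsmul F, smul_smul]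
    norm_num [h3]

end IsCyclicCubic

end Graded

section Graded

variable {F R K A : Type*} [Field F] [CommRing R] [CommRing K] [Ring A] [Algebra F R]
  [Algebra F K] [Algebra F A] [Algebra R K] [IsScalarTower F R K] [Algebra R A] [Module K A]
  [IsScalarTower F R A] [IsScalarTower F K A] [IsScalarTower R K A] [IsScalarTower K A A]
  {α ρ : F} {σ : K →ₐ[R] K} {z : K}

namespace IsCyclicCubic

/-- A central element commutes with `x`, so it is some `k ∈ K`; conjugation by the `u_j`, `v_j`
shows that `σ` fixes it, so a third of its trace is a preimage in `R`. -/
theorem exists_algebraMap_eq {x : A} (h : IsCyclicCubic α ρ σ z x) (h3 : (3 : F) ≠ 0)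
    (hρ : ρ ^ 2 + ρ + 1 = 0)
    (hdec : ∀ a : A, ∃ (k : K) (a₁ a₂ : A), IsTwisted σ a₁ ∧ IsTwisted (σ ∘ σ) a₂ ∧
      a = k • (1 : A) + a₁ + a₂)
    {J : Type*} [Fintype J] {u v : J → A} (hu : ∀ j, IsTwisted σ (u j)) (huv : ∑ j, u j * v j = 1)
    {a : A} (ha : ∀ b, a * b = b * a) : ∃ r : R, algebraMap R A r = a := by
  have hproj : ∃ k : K, a = k • (1 : A) := by
    have hp : proj (K := K) α z a = a := proj_eq_self h3 h.root fun k b ↦ by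
      rw [ha, smul_mul_assoc, ha, id]
    obtain ⟨k, a₁, a₂, ha₁, ha₂, hk⟩ := hdec a
    refine ⟨k, ?_⟩
    rw [← hp, hk, proj_add, proj_add, h.proj_eq_zero_of_twisted hρ ha₁,
      h.proj_eq_zero_of_twisted_twice hρ ha₂, proj_eq_self h3 h.root (isTwisted_smul_one k),
      add_zero, add_zero]
  obtain ⟨k, hk⟩ := hproj
  -- On `K`, the map `a ↦ ∑ u_j a v_j` is `σ`; on central elements it is the identity.
  have hconj {l : K} (hl : a = l • (1 : A)) : a = σ l • (1 : A) :=
    calc a = ∑ j, u j * a * v j := by simp only [← ha, mul_assoc, ← Finset.mul_sum, huv, mul_one]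
      _ = σ l • (1 : A) := by
        simp only [hl, (hu _).mul_smul_one, smul_mul_assoc, ← Finset.smul_sum, huv]
  obtain ⟨t, ht⟩ := exists_trace hρ h.map_root h.exists_repr k
  have h3a : (3 : F) • a = algebraMap R A t := by
    rw [Algebra.algebraMap_eq_smul_one, ← algebraMap_smul K t, ht, add_smul, add_smul, ← hk,
      ← hconj hk, ← hconj (hconj hk), ofNat_smul_eq_nsmul]
    abel
  refine ⟨(3⁻¹ : F) • t, ?_⟩
  rw [algebra_compatible_smul R, smul_eq_mul, map_mul, ← h3a, ← Algebra.smul_def,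
    algebraMap_smul, smul_smul, inv_mul_cancel₀ h3, one_smul]

/-- `1, x, x²` are independent over `R`. -/
theorem eq_zero_of_smul_one_eq_zero [FaithfulSMul R A] {x : A} (h : IsCyclicCubic α ρ σ z x)
    (h3 : (3 : F) ≠ 0) (hρ : ρ ^ 2 + ρ + 1 = 0) {J : Type*} [Fintype J] {u v : J → A}
    (hu : ∀ j, IsTwisted σ (u j)) (huv : ∑ j, u j * v j = 1) {r : Fin 3 → R}
    (hr : (∑ i, algebraMap R K (r i) * (algebraMap F K α * z ^ 2) ^ (i : ℕ)) • (1 : A) = 0) :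
    r = 0 := by
  have hinj := FaithfulSMul.algebraMap_injective R A
  have hconj {l : K} (hl : l • (1 : A) = 0) : σ l • (1 : A) = 0 :=
    calc σ l • (1 : A) = ∑ j, u j * l • (1 : A) * v j := by
          simp only [(hu _).mul_smul_one, smul_mul_assoc, ← Finset.smul_sum, huv]
      _ = 0 := by simp [hl]
  have hσF (k : F) : σ (algebraMap F K k) = algebraMap F K k :=
    (σ.restrictScalars F).commutes k
  have hρ' : algebraMap F K ρ ^ 2 + algebraMap F K ρ + 1 = 0 := by
    simpa using congrArg (algebraMap F K) hρ
  set k := ∑ i, algebraMap R K (r i) * (algebraMap F K α * z ^ 2) ^ (i : ℕ) with hk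
  ext i
  have key : algebraMap R K (3 * r i) = z ^ (i : ℕ) * k + σ (z ^ (i : ℕ) * k)
      + σ (σ (z ^ (i : ℕ) * k)) := by
    rw [hk]
    have hz := h.root
    simp only [Fin.sum_univ_three, Fin.val_zero, Fin.val_one, Fin.val_two, map_mul, map_pow,
      map_add, AlgHom.commutes, hσF, h.map_root, map_ofNat]
    generalize algebraMap F K ρ = p at *
    fin_cases i <;> simp <;> grind
  have h0 : (z ^ (i : ℕ) * k) • (1 : A) = 0 := by rw [mul_smul, hr, smul_zero]
  have : algebraMap R A (3 * r i) = 0 := by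
    rw [Algebra.algebraMap_eq_smul_one, ← algebraMap_smul K, key, add_smul, add_smul, h0, hconj h0,
      hconj (hconj h0)]
    simp
  have h3r : (3 : F) • r i = 0 := by
    rw [ofNat_smul_eq_nsmul, nsmul_eq_mul]
    exact hinj (by simpa using this)
  simpa [h3] using h3r

end IsCyclicCubic

end Graded

/-! ### Strong grading from smoothness of the curve -/

section Clifford

variable {F R K A : Type*} [Field F] [CommRing R] [CommRing K] [Ring A] [Algebra F R]
  [Algebra F K] [Algebra F A] [Algebra R K] [IsScalarTower F R K] [Algebra R A] [Module K A]
  [IsScalarTower F R A] [IsScalarTower F K A] [IsScalarTower R K A] [IsScalarTower K A A]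
  {c : CubicCoeffs F} {ρ : F} {σ : K →ₐ[R] K} {z : K} {x y₁ y₂ : A}

/-- `y₁y₂` is the conjugate `σ(y₂y₁)`, as if `y₁` were invertible. -/
theorem y₁_mul_y₂_eq_smul_one (h : IsCyclicCubic c.α ρ σ z x) (h3 : (3 : F) ≠ 0)
    (hρ : ρ ^ 2 + ρ + 1 = 0) {W : R}
    (hW : algebraMap R A W = z • (y₂ * y₁) + c.wCoeff ρ z • (1 : A))
    (hc : y₁ * y₂ = ρ • (y₂ * y₁) + c.commCoeff ρ z • (1 : A)) :
    y₁ * y₂ = σ (algebraMap F K c.α * z ^ 2 * (algebraMap R K W - c.wCoeff ρ z)) • (1 : A) := by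
  have hi := algebraMap_inv_three (K := K) h3
  have hρ' : algebraMap F K ρ ^ 2 + algebraMap F K ρ + 1 = 0 := by
    simpa using congrArg (algebraMap F K) hρ
  have hσF (k : F) : σ (algebraMap F K k) = algebraMap F K k :=
    (σ.restrictScalars F).commutes k
  have hz := h.root
  rw [hc, y₂_mul_y₁ (c := c) (ρ := ρ) (W := algebraMap R K W) h.root
    (by rw [algebraMap_smul, ← Algebra.algebraMap_eq_smul_one, hW]),
    ← algebraMap_smul K ρ, smul_smul, ← add_smul]
  congr 1
  simp only [commCoeff, wCoeff, map_sub, map_add, map_mul, map_pow, AlgHom.commutes, hσF,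
    h.map_root]
  clear hc hW
  generalize algebraMap F K 3⁻¹ = i at *
  generalize algebraMap F K ρ = p at *
  generalize algebraMap F K c.α = α at *
  grind

/-- `A` is spanned over `K` by `1, y₁, y₂², y₁², y₂`. -/
theorem exists_eq_smul_add {X : K} (hx : x = X • (1 : A)) (h1 : IsTwisted σ y₁)
    (h2 : IsTwisted (σ ∘ σ) y₂) (hgen : Algebra.adjoin F {x, y₁, y₂} = ⊤) {S S' : R} {k l : K}
    (hS : y₁ ^ 3 = algebraMap R A S) (hS' : y₂ ^ 3 = algebraMap R A S')
    (hk : y₂ * y₁ = k • (1 : A)) (hl : y₁ * y₂ = l • (1 : A)) (a : A) :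
    ∃ k₀ k₁ k₂ k₃ k₄ : K,
      a = k₀ • (1 : A) + k₁ • y₁ + k₂ • (y₂ * y₂) + k₃ • (y₁ * y₁) + k₄ • y₂ := by
  let P (a : A) : Prop := ∃ k₀ k₁ k₂ k₃ k₄ : K,
      a = k₀ • (1 : A) + k₁ • y₁ + k₂ • (y₂ * y₂) + k₃ • (y₁ * y₁) + k₄ • y₂
  have hadd {a b : A} : P a → P b → P (a + b) := by
    rintro ⟨a₀, a₁, a₂, a₃, a₄, rfl⟩ ⟨b₀, b₁, b₂, b₃, b₄, rfl⟩
    exact ⟨a₀ + b₀, a₁ + b₁, a₂ + b₂, a₃ + b₃, a₄ + b₄, by module⟩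
  have hsmul (m : K) {a : A} : P a → P (m • a) := by
    rintro ⟨a₀, a₁, a₂, a₃, a₄, rfl⟩
    exact ⟨m * a₀, m * a₁, m * a₂, m * a₃, m * a₄, by module⟩
  have hS₁ : y₁ * (y₁ * y₁) = algebraMap R K S • (1 : A) := by
    rw [algebraMap_smul, ← Algebra.algebraMap_eq_smul_one, ← hS, pow_succ', pow_two]
  have hS₂ : y₂ * (y₂ * y₂) = algebraMap R K S' • (1 : A) := by
    rw [algebraMap_smul, ← Algebra.algebraMap_eq_smul_one, ← hS', pow_succ', pow_two]
  have e1 : P 1 := ⟨1, 0, 0, 0, 0, by simp⟩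
  have ey₁ : P y₁ := ⟨0, 1, 0, 0, 0, by simp⟩
  have ey₂₂ : P (y₂ * y₂) := ⟨0, 0, 1, 0, 0, by simp⟩
  have ey₁₁ : P (y₁ * y₁) := ⟨0, 0, 0, 1, 0, by simp⟩
  have ey₂ : P y₂ := ⟨0, 0, 0, 0, 1, by simp⟩
  -- The span is stable under left multiplication by the generators.
  have hall (b : A) : ∀ a, P a → P (b * a) := by
    have hb : b ∈ Algebra.adjoin F {x, y₁, y₂} := hgen ▸ Algebra.mem_top
    induction hb using Algebra.adjoin_induction with
    | mem b hb =>
      rintro a ⟨k₀, k₁, k₂, k₃, k₄, rfl⟩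
      rcases hb with rfl | rfl | rfl
      · rw [hx, smul_mul_assoc, one_mul]
        exact hsmul _ ⟨k₀, k₁, k₂, k₃, k₄, rfl⟩
      · simp only [mul_add, h1 _ _, mul_one, hS₁, hl, ← mul_assoc b y₂ y₂, smul_mul_assoc, one_mul]
        exact hadd (hadd (hadd (hadd (hsmul _ ey₁) (hsmul _ ey₁₁)) (hsmul _ (hsmul _ ey₂)))
          (hsmul _ (hsmul _ e1))) (hsmul _ (hsmul _ e1))
      · simp only [mul_add, h2 _ _, mul_one, hS₂, hk, ← mul_assoc b y₁ y₁, smul_mul_assoc, one_mul]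
        exact hadd (hadd (hadd (hadd (hsmul _ ey₂) (hsmul _ (hsmul _ e1))) (hsmul _ (hsmul _ e1)))
          (hsmul _ (hsmul _ ey₁))) (hsmul _ ey₂₂)
    | algebraMap f =>
      intro a ha
      rw [← Algebra.smul_def, ← algebraMap_smul K]
      exact hsmul _ ha
    | add b b' _ _ hb hb' =>
      intro a ha
      rw [add_mul]
      exact hadd (hb a ha) (hb' a ha)
    | mul b b' _ _ hb hb' =>
      intro a ha
      rw [mul_assoc]
      exact hb _ (hb' a ha)
  simpa using hall a 1 e1

/-- The components of degree `1` and `2` of an element of `A`; that of degree `0` is a multiple of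
`1`. -/
theorem exists_graded_decomposition (h1 : IsTwisted σ y₁) (h2 : IsTwisted (σ ∘ σ) y₂)
    (hσ3 : ∀ k : K, σ (σ (σ k)) = k) {a : A} (ha : ∃ k₀ k₁ k₂ k₃ k₄ : K,
      a = k₀ • (1 : A) + k₁ • y₁ + k₂ • (y₂ * y₂) + k₃ • (y₁ * y₁) + k₄ • y₂) :
    ∃ (k : K) (a₁ a₂ : A), IsTwisted σ a₁ ∧ IsTwisted (σ ∘ σ) a₂ ∧ a = k • (1 : A) + a₁ + a₂ := by
  obtain ⟨k₀, k₁, k₂, k₃, k₄, rfl⟩ := ha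
  have hσ4 : (σ ∘ σ) ∘ (σ ∘ σ) = σ := funext fun k ↦ hσ3 (σ k)
  refine ⟨k₀, k₁ • y₁ + k₂ • (y₂ * y₂), k₃ • (y₁ * y₁) + k₄ • y₂, ?_, ?_, by abel⟩
  · exact (h1.smul _).add (IsTwisted.smul _ (by simpa only [hσ4] using h2.mul h2))
  · exact ((h1.mul h1).smul _).add (h2.smul _)

/-- Smoothness of the curve makes the grading strong: the partial derivatives of the equation of `E`
are `K`-combinations of `y₁³`, `y₂³`, `y₁y₂`, `y₂²y₁²`, which lie in `A₁A₂`, and also of `y₁³`,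
`y₂³`, `y₂y₁`, `y₁²y₂²`, which lie in `A₂A₁`. -/
theorem exists_strong_grading (h : IsCyclicCubic c.α ρ σ z x) (h3 : (3 : F) ≠ 0) (hα : c.α ≠ 0)
    (hρ : ρ ^ 2 + ρ + 1 = 0) (h1 : IsTwisted σ y₁) (h2 : IsTwisted (σ ∘ σ) y₂) {W S : R}
    (hS : y₁ ^ 3 = algebraMap R A S)
    (hS' : y₂ ^ 3 = algebraMap R A (algebraMap F R (ρ ^ 2 * c.e) * W - algebraMap F R c.D - S))
    (hk : y₂ * y₁ =
      (algebraMap F K c.α * z ^ 2 * (algebraMap R K W - c.wCoeff ρ z)) • (1 : A))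
    (hl : y₁ * y₂ =
      σ (algebraMap F K c.α * z ^ 2 * (algebraMap R K W - c.wCoeff ρ z)) • (1 : A)) {a b : R}
    (hab : a * (algebraMap F R c.D - algebraMap F R (ρ ^ 2 * c.e) * W + 2 * S)
      + b * (3 * algebraMap F R c.α * W ^ 2 - algebraMap F R (ρ ^ 2 * c.e) * S
        - algebraMap F R (ρ ^ 2 * (c.D₁ * c.D₂ / (9 * c.α)))) = 1) :
    (∃ u v : Fin 4 → A, (∀ j, IsTwisted σ (u j)) ∧ (∀ j, IsTwisted (σ ∘ σ) (v j)) ∧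
      ∑ j, u j * v j = 1) ∧
    (∃ u v : Fin 4 → A, (∀ j, IsTwisted (σ ∘ σ) (u j)) ∧ (∀ j, IsTwisted σ (v j)) ∧
      ∑ j, u j * v j = 1) := by
  have hi := algebraMap_inv_three (K := K) h3
  have hρ' : algebraMap F K ρ ^ 2 + algebraMap F K ρ + 1 = 0 := by
    simpa using congrArg (algebraMap F K) hρ
  have hσF (k : F) : σ (algebraMap F K k) = algebraMap F K k :=
    (σ.restrictScalars F).commutes k
  have hz := h.root
  have hσz := h.map_root
  have hz' := algebraMap_inv_eq_pow hα hz
  have e3 : c.D₁ * c.D₂ / (9 * c.α) = 3⁻¹ ^ 2 * c.D₁ * c.D₂ * c.α⁻¹ := by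
    rw [show (9 : F) = 3 ^ 2 by norm_num]; field_simp
  have hσ3 := h.map_map_map (by grind : ρ ^ 3 = 1)
  have hσ4 : (σ ∘ σ) ∘ (σ ∘ σ) = σ := funext fun k ↦ hσ3 (σ k)
  have hS₁ : y₁ * (y₁ * y₁) = algebraMap R K S • (1 : A) := by
    rw [algebraMap_smul, ← Algebra.algebraMap_eq_smul_one, ← hS, pow_succ', pow_two]
  have hS₂ : y₂ * (y₂ * y₂) =
      algebraMap R K (algebraMap F R (ρ ^ 2 * c.e) * W - algebraMap F R c.D - S) • (1 : A) := by
    rw [algebraMap_smul, ← Algebra.algebraMap_eq_smul_one, ← hS', pow_succ', pow_two]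
  have h11 : IsTwisted (σ ∘ σ) (y₁ * y₁) := h1.mul h1
  have h22 : IsTwisted σ (y₂ * y₂) := by simpa only [hσ4] using h2.mul h2
  replace hab := congrArg (algebraMap R K) hab
  rw [e3] at hab
  simp only [map_add, map_sub, map_mul, map_pow, map_ofNat, map_one,
    ← IsScalarTower.algebraMap_apply, hz'] at hab
  set k := algebraMap F K c.α * z ^ 2 * (algebraMap R K W - c.wCoeff ρ z) with hkdef
  have hk' (m : A) : y₂ * (y₁ * m) = k • m := by rw [← mul_assoc, hk, smul_mul_assoc, one_mul]
  have hl' (m : A) : y₁ * (y₂ * m) = σ k • m := by rw [← mul_assoc, hl, smul_mul_assoc, one_mul]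
  have hσa (r : R) : σ (algebraMap R K r) = algebraMap R K r := AlgHom.commutes _ _
  -- The derivative with respect to `S` is `y₁³ - y₂³`. The one with respect to `R` is `-ρ²e y₁³`
  -- plus the derivative of the norm `k σ(k) σ²(k)` in `W`; here `k`, `σ(k)`, `σ²(k)` have the
  -- derivatives `αz²`, `ραz²`, `ρ²αz²`. The factors `σ(k) = y₁y₂` and `σ²(k) k = y₂²y₁²` serve for
  -- `A₁A₂`, and the factors `k = y₂y₁` and `σ(k) σ²(k) = y₁²y₂²` for `A₂A₁`.
  refine ⟨⟨![(algebraMap R K (a - b * algebraMap F R (ρ ^ 2 * c.e))) • y₁,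
      (-algebraMap R K a) • (y₂ * y₂),
      (algebraMap R K b * algebraMap F K c.α * algebraMap F K ρ ^ 2 * z * (z * k
        + algebraMap F K ρ * z * σ (σ k))) • y₁,
      (algebraMap R K b * algebraMap F K c.α * algebraMap F K ρ * z ^ 2) • (y₂ * y₂)],
    ![y₁ * y₁, y₂, y₂, y₁ * y₁], ?_, ?_, ?_⟩,
    ⟨![(algebraMap R K (a - b * algebraMap F R (ρ ^ 2 * c.e))) • (y₁ * y₁),
      (-algebraMap R K a) • y₂,
      (algebraMap R K b * algebraMap F K c.α * z * (algebraMap F K ρ ^ 2 * z * σ k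
        + algebraMap F K ρ * z * σ (σ k))) • y₂,
      (algebraMap R K b * algebraMap F K c.α * z ^ 2) • (y₁ * y₁)],
    ![y₁, y₂ * y₂, y₁, y₂ * y₂], ?_, ?_, ?_⟩⟩
  · intro j
    fin_cases j
    exacts [h1.smul _, h22.smul _, h1.smul _, h22.smul _]
  · intro j
    fin_cases j
    exacts [h11, h2, h2, h11]
  · rw [Fin.sum_univ_four]
    change _ • y₁ * (y₁ * y₁) + _ • (y₂ * y₂) * y₂ + _ • y₁ * y₂ + _ • (y₂ * y₂) * (y₁ * y₁) = _
    simp only [smul_mul_assoc, mul_assoc, hS₁, hS₂, hl, hk', h2 _ _, hk, smul_smul, ← add_smul]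
    convert one_smul K (1 : A)
    simp only [Function.comp_apply, map_add, map_sub, map_mul, map_pow,
      ← IsScalarTower.algebraMap_apply, hkdef, wCoeff, hσF, hσa, hσz]
    clear_value k
    clear hk' hl' hkdef hk hl hS₁ hS₂ h11 h22 hσ4 hσ3 hσF hσa hσz hS hS' h1 h2 h e3
    generalize algebraMap F K 3⁻¹ = i at *
    generalize algebraMap F K ρ = p at *
    generalize algebraMap F K c.α = α at *
    generalize algebraMap F K c.D₁ = D₁ at *
    generalize algebraMap F K c.D₂ = D₂ at *
    rw [← hab]
    grind
  · intro j
    fin_cases j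
    exacts [h11.smul _, h2.smul _, h2.smul _, h11.smul _]
  · intro j
    fin_cases j
    exacts [h1, h22, h1, h22]
  · rw [Fin.sum_univ_four]
    change _ • (y₁ * y₁) * y₁ + _ • y₂ * (y₂ * y₂) + _ • y₂ * y₁ + _ • (y₁ * y₁) * (y₂ * y₂) = _
    simp only [smul_mul_assoc, mul_assoc, hS₁, hS₂, hk, hl', h1 _ _, hl, smul_smul, ← add_smul]
    convert one_smul K (1 : A)
    simp only [map_add, map_sub, map_mul, map_pow,
      ← IsScalarTower.algebraMap_apply, hkdef, wCoeff, hσF, hσa, hσz]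
    clear_value k
    clear hk' hl' hkdef hk hl hS₁ hS₂ h11 h22 hσ4 hσ3 hσF hσa hσz hS hS' h1 h2 h e3
    generalize algebraMap F K 3⁻¹ = i at *
    generalize algebraMap F K ρ = p at *
    generalize algebraMap F K c.α = α at *
    generalize algebraMap F K c.D₁ = D₁ at *
    generalize algebraMap F K c.D₂ = D₂ at *
    rw [← hab]
    grind

end Clifford

/-! ### Center, Azumaya property and rank for an abstract triple -/

section Rank

variable {F R K A : Type*} [Field F] [CommRing R] [CommRing K] [Ring A] [Algebra F R]
  [Algebra F K] [Algebra F A] [Algebra R K] [IsScalarTower F R K] [Algebra R A] [Module K A]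
  [IsScalarTower F R A] [IsScalarTower F K A] [IsScalarTower R K A] [IsScalarTower K A A]
  {α ρ : F} {σ : K →ₐ[R] K} {z : K} {x y₁ y₂ : A}

/-- The products `xⁱ y₁ʲ` are independent. The weight `0` component of a relation has coefficients
in `K` and is handled by the independence of `1, x, x²`; multiplication by `y₁` or `y₁²` brings the
other components to weight `0`, at the cost of the factor `S = y₁³`. -/
theorem IsCyclicCubic.linearIndependent [FaithfulSMul R A] [IsDomain R]
    (h : IsCyclicCubic α ρ σ z x) (h3 : (3 : F) ≠ 0) (hρ : ρ ^ 2 + ρ + 1 = 0)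
    (h1 : IsTwisted σ y₁) {S : R} (hS : y₁ ^ 3 = algebraMap R A S) (hS0 : S ≠ 0)
    {J : Type*} [Fintype J] {u v : J → A}
    (hu : ∀ j, IsTwisted σ (u j)) (huv : ∑ j, u j * v j = 1) :
    LinearIndependent R
      (fun l : Fin 3 × Fin 3 ↦ (algebraMap F K α * z ^ 2) ^ (l.2 : ℕ) • y₁ ^ (l.1 : ℕ)) := by
  rw [Fintype.linearIndependent_iff]
  intro g hg
  set X := algebraMap F K α * z ^ 2 with hX
  let k (j : Fin 3) : K := ∑ i, algebraMap R K (g (j, i)) * X ^ (i : ℕ)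
  have h0 : k 0 • (1 : A) + k 1 • y₁ + k 2 • (y₁ * y₁) = 0 := by
    rw [Fintype.sum_prod_type] at hg
    have (j : Fin 3) : ∑ i, g (j, i) • X ^ (i : ℕ) • y₁ ^ (j : ℕ) = k j • y₁ ^ (j : ℕ) := by
      simp only [k, Finset.sum_smul, mul_smul, algebraMap_smul]
    simpa only [this, Fin.sum_univ_three, Fin.val_zero, Fin.val_one, Fin.val_two, pow_zero, pow_one,
      pow_two] using hg
  have h11 : IsTwisted (σ ∘ σ) (y₁ * y₁) := h1.mul h1
  have key {a b d : K} (habd : a • (1 : A) + b • y₁ + d • (y₁ * y₁) = 0) : a • (1 : A) = 0 := by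
    have := congrArg (proj (K := K) α z) habd
    rwa [proj_add, proj_add, h.proj_eq_zero_of_twisted hρ (h1.smul b),
      h.proj_eq_zero_of_twisted_twice hρ (h11.smul d), proj_eq_self h3 h.root
        (isTwisted_smul_one a), add_zero, add_zero,
      show proj (K := K) α z (0 : A) = 0 by simp [proj]] at this
  have hSK (m : A) : y₁ * (y₁ * (y₁ * m)) = algebraMap R K S • m := by
    rw [algebraMap_smul, Algebra.smul_def, ← hS]; simp only [pow_succ, pow_zero, one_mul, mul_assoc]
  have hSK' : y₁ * (y₁ * y₁) = algebraMap R K S • (1 : A) := by simpa using hSK 1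
  have hk (j : Fin 3) : (algebraMap R K S * k j) • (1 : A) = 0 := by
    have hk0 : (algebraMap R K S * k 0) • (1 : A) = 0 := by
      refine key (b := algebraMap R K S * k 1) (d := algebraMap R K S * k 2) ?_
      simpa only [smul_add, smul_smul, smul_zero] using congrArg (algebraMap R K S • ·) h0
    have hk1 : (algebraMap R K S * k 1) • (1 : A) = 0 := by
      refine key (b := algebraMap R K S * k 2) (d := k 0) ?_
      have := congrArg (· * (y₁ * y₁)) h0
      simp only [add_mul, smul_mul_assoc, mul_assoc, hSK', zero_mul, one_mul] at this
      simp only [h1 _ _, AlgHom.commutes, mul_one] at this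
      rw [← this]
      module
    have hk2 : (algebraMap R K S * k 2) • (1 : A) = 0 := by
      refine key (b := k 0) (d := k 1) ?_
      have := congrArg (· * y₁) h0
      simp only [add_mul, smul_mul_assoc, mul_assoc, hSK', zero_mul, one_mul] at this
      rw [← this]
      module
    fin_cases j
    exacts [hk0, hk1, hk2]
  rintro ⟨j, i⟩
  have := h.eq_zero_of_smul_one_eq_zero h3 hρ hu huv (r := fun i ↦ S * g (j, i)) (by
    rw [← hk j]
    simp only [k, Finset.mul_sum, map_mul, mul_assoc, ← hX])
  simpa [hS0] using congrFun this i

/-- The products `xⁱ y₁ʲ` span `A` up to the factor `S = y₁³`, since `S y₂ = (y₂y₁) y₁²` and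
`S y₂² = y₂ (y₂y₁) y₁²` with `y₂y₁ ∈ K`. -/
theorem IsCyclicCubic.smul_mem_span (h : IsCyclicCubic α ρ σ z x) (hα : α ≠ 0)
    (h2 : IsTwisted (σ ∘ σ) y₂) {S : R} (hS : y₁ ^ 3 = algebraMap R A S) {k : K}
    (hk : y₂ * y₁ = k • (1 : A)) {a : A} (ha : ∃ k₀ k₁ k₂ k₃ k₄ : K,
      a = k₀ • (1 : A) + k₁ • y₁ + k₂ • (y₂ * y₂) + k₃ • (y₁ * y₁) + k₄ • y₂) :
    S • a ∈ Submodule.span R (Set.range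
      (fun l : Fin 3 × Fin 3 ↦ (algebraMap F K α * z ^ 2) ^ (l.2 : ℕ) • y₁ ^ (l.1 : ℕ))) := by
  have hmem (j i : Fin 3) : (algebraMap F K α * z ^ 2) ^ (i : ℕ) • y₁ ^ (j : ℕ) ∈
      Submodule.span R (Set.range
      (fun l : Fin 3 × Fin 3 ↦ (algebraMap F K α * z ^ 2) ^ (l.2 : ℕ) • y₁ ^ (l.1 : ℕ))) :=
    Submodule.subset_span ⟨(j, i), rfl⟩
  set N := Submodule.span R (Set.range
      (fun l : Fin 3 × Fin 3 ↦ (algebraMap F K α * z ^ 2) ^ (l.2 : ℕ) • y₁ ^ (l.1 : ℕ)))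
  have hαα : algebraMap F K α⁻¹ * algebraMap F K α = 1 := by
    rw [← map_mul, inv_mul_cancel₀ hα, map_one]
  have hkN (j : Fin 3) (k : K) : k • y₁ ^ (j : ℕ) ∈ N := by
    obtain ⟨r₀, r₁, r₂, rfl⟩ := h.exists_repr k
    have e1 : z = algebraMap R K (algebraMap F R α⁻¹) * (algebraMap F K α * z ^ 2) ^ 2 := by
      rw [← IsScalarTower.algebraMap_apply]
      linear_combination (-z) * hαα - algebraMap F K α⁻¹ * algebraMap F K α * z * h.root
    have e2 : z ^ 2 = algebraMap R K (algebraMap F R α⁻¹) * (algebraMap F K α * z ^ 2) := by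
      rw [← IsScalarTower.algebraMap_apply]
      linear_combination (-z ^ 2) * hαα
    have : (algebraMap R K r₀ + algebraMap R K r₁ * z + algebraMap R K r₂ * z ^ 2) • y₁ ^ (j : ℕ) =
        r₀ • (algebraMap F K α * z ^ 2) ^ ((0 : Fin 3) : ℕ) • y₁ ^ (j : ℕ)
        + (r₁ * algebraMap F R α⁻¹) • (algebraMap F K α * z ^ 2) ^ ((2 : Fin 3) : ℕ) • y₁ ^ (j : ℕ)
        + (r₂ * algebraMap F R α⁻¹) •
          (algebraMap F K α * z ^ 2) ^ ((1 : Fin 3) : ℕ) • y₁ ^ (j : ℕ) := by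
      simp only [← algebraMap_smul K r₀, ← algebraMap_smul K (r₁ * _), ← algebraMap_smul K (r₂ * _),
        smul_smul, ← add_smul, map_mul, Fin.val_zero, Fin.val_one, Fin.val_two, pow_zero, pow_one]
      congr 1
      rw [mul_assoc _ (algebraMap R K (algebraMap F R α⁻¹)), ← e1,
        mul_assoc _ (algebraMap R K (algebraMap F R α⁻¹)), ← e2, mul_one]
    rw [this]
    exact N.add_mem (N.add_mem (N.smul_mem _ (hmem _ _)) (N.smul_mem _ (hmem _ _)))
      (N.smul_mem _ (hmem _ _))
  have hk0 (k : K) : k • (1 : A) ∈ N := by simpa using hkN 0 k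
  have hk1 (k : K) : k • y₁ ∈ N := by simpa using hkN 1 k
  have hk2 (k : K) : k • (y₁ * y₁) ∈ N := by simpa [pow_two] using hkN 2 k
  have hk' (m : A) : y₂ * (y₁ * m) = k • m := by rw [← mul_assoc, hk, smul_mul_assoc, one_mul]
  have hSy (b : A) : S • b = b * (y₁ * (y₁ * y₁)) := by
    rw [Algebra.smul_def, Algebra.commutes, ← hS, pow_succ', pow_two]
  have e2 : S • y₂ = k • (y₁ * y₁) := by rw [hSy, hk']
  have e22 : S • (y₂ * y₂) = (σ (σ k) * k) • y₁ := by
    rw [hSy, mul_assoc, hk', h2 _ _, hk', smul_smul, Function.comp_apply]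
  obtain ⟨k₀, k₁, k₂, k₃, k₄, rfl⟩ := ha
  have hcomm (m : K) (b : A) : S • m • b = m • S • b := by
    rw [← algebraMap_smul K S, ← algebraMap_smul K S, smul_smul, smul_smul, mul_comm]
  simp only [smul_add]
  refine N.add_mem (N.add_mem (N.add_mem (N.add_mem (N.smul_mem _ (hk0 _))
    (N.smul_mem _ (hk1 _))) ?_) (N.smul_mem _ (hk2 _))) ?_
  · rw [hcomm, e22, smul_smul]
    exact hk1 _
  · rw [hcomm, e2, smul_smul]
    exact hk2 _

end Rank

section Triple

/-- Elements `x`, `y₁`, `y₂` of an algebra such that `x` and `y = y₀ + y₁ + y₂`, where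
`y₀ = (r + e x⁻¹ + β x⁻²) / 3`, satisfy the defining relations of `C_Φ`, and such that `y₁`, `y₂`
are eigenvectors for conjugation by `x`. They are required to generate the algebra. -/
structure IsCliffordTriple {F A : Type*} [Field F] [Ring A] [Algebra F A] (c : CubicCoeffs F)
    (ρ : F) (x y y₁ y₂ : A) : Prop where
  x_pow_three : x ^ 3 = algebraMap F A c.α
  y₁_mul_x : y₁ * x = ρ • (x * y₁)
  y₂_mul_x : y₂ * x = ρ ^ 2 • (x * y₂)
  y_eq : y = (3⁻¹ : F) • (c.r • (1 : A) + c.e • (c.α⁻¹ • x ^ 2) + c.β • (c.α⁻¹ • x ^ 2) ^ 2)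
    + y₁ + y₂
  rel_two : x * y * y + y * x * y + y * y * x - c.r • (x * y + y * x) - c.e • y - c.t • x
    - c.γ • 1 = 0
  rel_three : y ^ 3 - c.r • y ^ 2 - c.t • y - c.δ • 1 = 0
  adjoin_eq_top : Algebra.adjoin F {x, y₁, y₂} = ⊤

/-- The element `w` attached to `x`, `y₁`, `y₂`. -/
def wOf {F A : Type*} [Field F] [Ring A] [Algebra F A] (c : CubicCoeffs F) (ρ : F)
    (x y₁ y₂ : A) : A :=
  c.α⁻¹ • x ^ 2 * y₂ * y₁ + (ρ ^ 2 * (c.D₁ / (3 * c.α))) • x + (c.D₂ / (9 * c.α)) • c.α⁻¹ • x ^ 2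

section Scalars

variable {F R K A : Type*} [Field F] [CommRing R] [CommRing K] [Ring A] [Algebra F R]
  [Algebra F K] [Algebra F A] [Algebra R K] [Module K A] [IsScalarTower F K A]
  [IsScalarTower K A A] {ρ : F} {σ : K →ₐ[R] K} {z : K} {x : A}

/-- `z` acts as `x⁻¹ = α⁻¹x²`. -/
theorem IsCyclicCubic.inv_smul_sq {α : F} (h : IsCyclicCubic α ρ σ z x) (hα : α ≠ 0) :
    α⁻¹ • x ^ 2 = z • (1 : A) := by
  have hx : x = (algebraMap F K α * z ^ 2) • (1 : A) := by rw [h.smul_eq, mul_one]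
  have : (algebraMap F K α * z ^ 2) * (algebraMap F K α * z ^ 2) = algebraMap F K α * z := by
    linear_combination (algebraMap F K α * z) * h.root
  rw [pow_two, ← h.smul_eq x, hx, smul_smul, this, mul_smul, algebraMap_smul, smul_smul,
    inv_mul_cancel₀ hα, one_smul]

theorem wOf_eq {c : CubicCoeffs F} {y₁ y₂ : A} (h : IsCyclicCubic c.α ρ σ z x) (h3 : (3 : F) ≠ 0)
    (hα : c.α ≠ 0) :
    c.wOf ρ x y₁ y₂ = z • (y₂ * y₁) + c.wCoeff ρ z • (1 : A) := by
  have hz' := algebraMap_inv_eq_pow hα h.root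
  have hx : x = (algebraMap F K c.α * z ^ 2) • (1 : A) := by rw [h.smul_eq, mul_one]
  have e1 : c.D₁ / (3 * c.α) = 3⁻¹ * c.D₁ * c.α⁻¹ := by field_simp
  have e2 : c.D₂ / (9 * c.α) = 3⁻¹ ^ 2 * c.D₂ * c.α⁻¹ := by
    rw [show (9 : F) = 3 ^ 2 by norm_num]; field_simp
  rw [wOf, h.inv_smul_sq hα, hx, e1, e2, ← algebraMap_smul K (_ * _ : F),
    ← algebraMap_smul K (_ * c.α⁻¹), smul_smul, smul_smul, smul_mul_assoc, one_mul, smul_mul_assoc,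
    add_assoc, ← add_smul]
  congr 2
  simp only [map_mul, map_pow, hz', wCoeff]
  linear_combination (algebraMap F K ρ ^ 2 * algebraMap F K 3⁻¹ * algebraMap F K c.D₁ * z ^ 2) *
    h.root

end Scalars

namespace IsCliffordTriple

section Scalars

variable {F R K A : Type*} [Field F] [CommRing R] [CommRing K] [Ring A] [Algebra F R]
  [Algebra F K] [Algebra F A] [Algebra R K] [IsScalarTower F R K] [Algebra R A] [Module K A]
  [IsScalarTower F R A] [IsScalarTower F K A] [IsScalarTower R K A] [IsScalarTower K A A]
  {c : CubicCoeffs F} {ρ : F} {σ : K →ₐ[R] K} {z : K} {x y y₁ y₂ : A}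

variable (t : IsCliffordTriple c ρ x y y₁ y₂) (h : IsCyclicCubic c.α ρ σ z x)
include t h

theorem isTwisted_y₁ (hα : c.α ≠ 0) : IsTwisted σ y₁ :=
  IsTwisted.of_mul_eq hα h.root h.exists_repr h.smul_eq h.map_root t.y₁_mul_x

theorem isTwisted_y₂ (hα : c.α ≠ 0) : IsTwisted (σ ∘ σ) y₂ := by
  have hσF (k : F) : σ (algebraMap F K k) = algebraMap F K k :=
    (σ.restrictScalars F).commutes k
  refine IsTwisted.of_mul_eq (τ := σ.comp σ) hα h.root h.exists_repr h.smul_eq ?_ t.y₂_mul_x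
  rw [AlgHom.comp_apply, h.map_root, map_mul, map_pow, hσF, h.map_root, map_pow]
  ring

theorem y_eq' (hα : c.α ≠ 0) : y = c.y₀Coeff z • (1 : A) + y₁ + y₂ := by
  rw [t.y_eq, h.inv_smul_sq hα]
  simp only [y₀Coeff, mul_smul, add_smul, algebraMap_smul, pow_two, smul_mul_assoc, one_mul]

theorem mul_comm' (h3 : (3 : F) ≠ 0) (hα : c.α ≠ 0) (hρ : ρ ^ 2 + ρ + 1 = 0) :
    y₁ * y₂ = ρ • (y₂ * y₁) + c.commCoeff ρ z • (1 : A) :=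
  c.y₁_mul_y₂ (σ := σ.restrictScalars F) h3 hα hρ h.root h.map_root
    (fun k ↦ t.isTwisted_y₁ h hα k) (fun k ↦ t.isTwisted_y₂ h hα k)
    (by rw [h.smul_eq, mul_one]) (t.y_eq' h hα) t.rel_two

end Scalars

variable {F A : Type*} [Field F] [Ring A] [Algebra F A]
  {c : CubicCoeffs F} {ρ : F} {x y y₁ y₂ : A} (t : IsCliffordTriple c ρ x y y₁ y₂)
include t

theorem commute_of_commute {a : A} (hx : Commute a x) (h1 : Commute a y₁) (h2 : Commute a y₂)
    (b : A) : Commute a b := by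
  have hb : b ∈ Algebra.adjoin F {x, y₁, y₂} := t.adjoin_eq_top ▸ Algebra.mem_top
  induction hb using Algebra.adjoin_induction with
  | mem b hb => rcases hb with rfl | rfl | rfl <;> assumption
  | algebraMap f => exact Algebra.commute_algebraMap_right f a
  | add b b' _ _ hb hb' => exact hb.add_right hb'
  | mul b b' _ _ hb hb' => exact hb.mul_right hb'

theorem wOf_mem_center (h3 : (3 : F) ≠ 0) (hα : c.α ≠ 0) (hρ : ρ ^ 2 + ρ + 1 = 0) :
    c.wOf ρ x y₁ y₂ ∈ Subalgebra.center F A := by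
  obtain ⟨K, _, _, _, _, _, _, _, _, σ, z, hz, hσ, hK, hx⟩ :=
    exists_kummer (R := Subalgebra.center F A) hα (by grind : ρ ^ 3 = 1) t.x_pow_three
  have h : IsCyclicCubic c.α ρ σ z x := ⟨hz, hσ, hK, hx⟩
  have h1 := t.isTwisted_y₁ h hα
  have h2 := t.isTwisted_y₂ h hα
  rw [wOf_eq h h3 hα]
  refine Subalgebra.mem_center_iff.2 fun b ↦ (t.commute_of_commute ?_ ?_ ?_ b).symm
  · have h0 : IsTwisted (id : K → K) (z • (y₂ * y₁) + c.wCoeff ρ z • (1 : A)) := by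
      refine ((h2.mul h1).smul z |>.congr fun k ↦ ?_).add (isTwisted_smul_one _)
      exact h.map_map_map (by grind : ρ ^ 3 = 1) k
    rw [commute_iff_eq, ← hx, ← mul_one x, ← hx, h0, mul_one, id]
  · exact (y₁_mul_w (σ := σ.restrictScalars F) h3 hρ hσ (fun k ↦ h1 k)
      (t.mul_comm' h h3 hα hρ)).symm
  · exact (y₂_mul_w (σ := σ.restrictScalars F) h3 hρ hσ (fun k ↦ h2 k)
      (t.mul_comm' h h3 hα hρ)).symm

theorem y₁_pow_three_mem_center (h3 : (3 : F) ≠ 0) (hα : c.α ≠ 0) (hρ : ρ ^ 2 + ρ + 1 = 0) :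
    y₁ ^ 3 ∈ Subalgebra.center F A := by
  obtain ⟨K, _, _, _, _, _, _, _, _, σ, z, hz, hσ, hK, hx⟩ :=
    exists_kummer (R := Subalgebra.center F A) hα (by grind : ρ ^ 3 = 1) t.x_pow_three
  have h : IsCyclicCubic c.α ρ σ z x := ⟨hz, hσ, hK, hx⟩
  have h1 := t.isTwisted_y₁ h hα
  refine Subalgebra.mem_center_iff.2 fun b ↦ (t.commute_of_commute ?_ ?_ ?_ b).symm
  · have h0 : IsTwisted (id : K → K) (y₁ ^ 3) := by
      rw [pow_succ, pow_two]
      exact ((h1.mul h1).mul h1).congr fun k ↦ h.map_map_map (by grind : ρ ^ 3 = 1) k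
    rw [commute_iff_eq, ← hx, ← mul_one x, ← hx, h0, mul_one, id]
  · exact (Commute.refl y₁).pow_left 3
  · exact y₁_pow_three_mul_y₂ (σ := σ.restrictScalars F) h3 hρ hσ (fun k ↦ h1 k)
      (t.mul_comm' h h3 hα hρ)

/-- The second cube `y₂³` is determined by `w` and `y₁³`, hence central as well. -/
theorem y₂_pow_three (h3 : (3 : F) ≠ 0) (hα : c.α ≠ 0) (hρ : ρ ^ 2 + ρ + 1 = 0) :
    y₂ ^ 3 = (ρ ^ 2 * c.e) • c.wOf ρ x y₁ y₂ - c.D • (1 : A) - y₁ ^ 3 := by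
  obtain ⟨K, _, _, _, _, _, _, _, _, σ, z, hz, hσ, hK, hx⟩ :=
    exists_kummer (R := Subalgebra.center F A) hα (by grind : ρ ^ 3 = 1) t.x_pow_three
  have h : IsCyclicCubic c.α ρ σ z x := ⟨hz, hσ, hK, hx⟩
  rw [wOf_eq h h3 hα, ← y₁_pow_three_add_y₂_pow_three h3 hα hρ hz (σ := σ.restrictScalars F) hσ
    (fun k ↦ t.isTwisted_y₁ h hα k) (fun k ↦ t.isTwisted_y₂ h hα k) (t.mul_comm' h h3 hα hρ)
      (t.y_eq' h hα) t.rel_three, add_sub_cancel_left]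

section Center

variable {R : Type*} [CommRing R] [Algebra F R] [Algebra R A] [IsScalarTower F R A] {W S : R}

/-- The pair `(w, y₁³)` is a point of `E`: the norm of `y₂y₁` equals
`y₂³ y₁³ = (ρ²e w - D - y₁³) y₁³`. -/
theorem curve_equation [FaithfulSMul R A] (h3 : (3 : F) ≠ 0) (hα : c.α ≠ 0) (hρ : ρ ^ 2 + ρ + 1 = 0)
    (hW : algebraMap R A W = c.wOf ρ x y₁ y₂) (hS : algebraMap R A S = y₁ ^ 3) :
    MvPolynomial.aeval ![W, S] (c.curvePoly ρ) = 0 := by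
  obtain ⟨K, _, _, _, _, _, _, _, _, σ, z, hz, hσ, hK, hx⟩ :=
    exists_kummer (R := R) hα (by grind : ρ ^ 3 = 1) t.x_pow_three
  have h : IsCyclicCubic c.α ρ σ z x := ⟨hz, hσ, hK, hx⟩
  have hN := y₂_pow_three_mul_y₁_pow_three (c := c) (y₁ := y₁)
    (σ := σ.restrictScalars F) h3 hα hρ hz hσ (fun k ↦ t.isTwisted_y₂ h hα k)
    (W := algebraMap R K W) (σ.commutes W) (by
      rw [← wOf_eq h h3 hα, ← hW, algebraMap_smul, Algebra.algebraMap_eq_smul_one])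
  rw [t.y₂_pow_three h3 hα hρ, ← hW, ← hS] at hN
  simp only [IsScalarTower.algebraMap_apply F R K, ← map_pow, ← map_mul, ← map_sub, algebraMap_smul]
    at hN
  simp only [← algebraMap_smul R (_ : F) (_ : A), Algebra.smul_def (_ : R) (_ : A), mul_one,
    ← map_mul, ← map_sub] at hN
  have := FaithfulSMul.algebraMap_injective R A hN
  simp only [curvePoly, map_add, map_sub, map_mul, map_pow, MvPolynomial.aeval_X,
    MvPolynomial.algHom_C, Matrix.cons_val_zero, Matrix.cons_val_one] at this ⊢
  linear_combination -this

/-- If the partial derivatives of the equation of `E` generate the unit ideal of `R`, then `R` maps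
onto the center of `A`, and `A` is Azumaya of rank `9` over `R`. -/
theorem center_and_azumaya (h3 : (3 : F) ≠ 0) (hα : c.α ≠ 0) (hρ : ρ ^ 2 + ρ + 1 = 0)
    (hW : algebraMap R A W = c.wOf ρ x y₁ y₂) (hS : algebraMap R A S = y₁ ^ 3)
    (hsm : ∃ a b : R, a * (algebraMap F R c.D - algebraMap F R (ρ ^ 2 * c.e) * W + 2 * S)
      + b * (3 * algebraMap F R c.α * W ^ 2 - algebraMap F R (ρ ^ 2 * c.e) * S
        - algebraMap F R (ρ ^ 2 * (c.D₁ * c.D₂ / (9 * c.α)))) = 1) :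
    (∀ a ∈ Subalgebra.center F A, ∃ r, algebraMap R A r = a) ∧
    (FaithfulSMul R A → IsAzumaya R A) ∧
    (FaithfulSMul R A → IsDomain R → S ≠ 0 →
      ∀ p : PrimeSpectrum R, Module.rankAtStalk (R := R) A p = 9) := by
  obtain ⟨K, _, _, _, _, _, _, _, _, σ, z, hz, hσ, hK, hx⟩ :=
    exists_kummer (R := R) hα (by grind : ρ ^ 3 = 1) t.x_pow_three
  have h : IsCyclicCubic c.α ρ σ z x := ⟨hz, hσ, hK, hx⟩
  have h1 := t.isTwisted_y₁ h hα
  have h2 := t.isTwisted_y₂ h hα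
  have hW' := hW.trans (wOf_eq h h3 hα)
  have hc := t.mul_comm' h h3 hα hρ
  have hk := y₂_mul_y₁ (c := c) (ρ := ρ) (y₁ := y₁) (y₂ := y₂) (W := algebraMap R K W) h.root
    (by rw [algebraMap_smul, ← Algebra.algebraMap_eq_smul_one, hW'])
  have hl := y₁_mul_y₂_eq_smul_one h h3 hρ hW' hc
  have hS' : y₂ ^ 3 = algebraMap R A (algebraMap F R (ρ ^ 2 * c.e) * W - algebraMap F R c.D
    - S) := by
    rw [t.y₂_pow_three h3 hα hρ, map_sub, map_sub, map_mul, hW, hS,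
      ← IsScalarTower.algebraMap_apply, ← IsScalarTower.algebraMap_apply, Algebra.smul_def,
      Algebra.algebraMap_eq_smul_one c.D]
  obtain ⟨a, b, hab⟩ := hsm
  obtain ⟨⟨u, v, hu, hv, huv⟩, ⟨u', v', hu', hv', huv'⟩⟩ :=
    exists_strong_grading h h3 hα hρ h1 h2 hS.symm hS' hk hl hab
  have hspan := exists_eq_smul_add (by rw [hx, mul_one]) h1 h2 t.adjoin_eq_top hS.symm hS' hk hl
  have hdec (a : A) := exists_graded_decomposition h1 h2 (h.map_map_map (by grind : ρ ^ 3 = 1))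
    (hspan a)
  have haz (hf : FaithfulSMul R A) : IsAzumaya R A :=
    h.isAzumaya h3 hρ hdec hu hv hu' hv' huv huv'
  refine ⟨fun a ha ↦ h.exists_algebraMap_eq h3 hρ hdec hu huv fun b ↦
    (Subalgebra.mem_center_iff.1 ha b).symm, haz, fun hf _ hS0 p ↦ ?_⟩
  have := haz hf
  exact Module.rankAtStalk_eq_of_linearIndependent
    (h.linearIndependent h3 hρ h1 hS.symm hS0 hu huv) hS0
    (fun a ↦ h.smul_mem_span hα h2 hS.symm hk (hspan a)) p

end Center

end IsCliffordTriple

end Triple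

/-! ### The triple of the Clifford algebra, and smoothness of `E` -/

section Presentation

variable {F : Type*} [Field F] (c : CubicCoeffs F)

/-- The image of `Φ(ax + by, a, b)` under an algebra homomorphism. -/
theorem map_aeval_Phi {A : Type*} [Ring A] [Algebra F A] (g : FreeAlgebra F (Fin 2) →ₐ[F] A)
    (v : Fin 2 → F) :
    g (Polynomial.aeval (∑ i, v i • FreeAlgebra.ι F i) (c.Phi.map (MvPolynomial.eval v))) =
      (v 0 • g (FreeAlgebra.ι F 0) + v 1 • g (FreeAlgebra.ι F 1)) ^ 3
      - (c.r * v 1) • (v 0 • g (FreeAlgebra.ι F 0) + v 1 • g (FreeAlgebra.ι F 1)) ^ 2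
      - (c.e * v 0 * v 1 + c.t * v 1 ^ 2) •
        (v 0 • g (FreeAlgebra.ι F 0) + v 1 • g (FreeAlgebra.ι F 1))
      - (c.α * v 0 ^ 3 + c.β * v 0 ^ 2 * v 1 + c.γ * v 0 * v 1 ^ 2 + c.δ * v 1 ^ 3) • (1 : A) := by
  simp [Phi, Algebra.smul_def, Fin.sum_univ_two]

/-- The defining relation of `C_Φ` for the pair `(a, b)`. -/
theorem rel (a b : F) :
    (a • c.x + b • c.y) ^ 3 - (c.r * b) • (a • c.x + b • c.y) ^ 2
      - (c.e * a * b + c.t * b ^ 2) • (a • c.x + b • c.y)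
      - (c.α * a ^ 3 + c.β * a ^ 2 * b + c.γ * a * b ^ 2 + c.δ * b ^ 3) • (1 : c.Cliff) = 0 := by
  have h := RingQuot.mkAlgHom_rel F (GenCliffordRel.of (Φ := c.Phi) ![a, b])
  rw [map_zero, map_aeval_Phi] at h
  exact h

/-- The defining relation for `(a, b)` holds coefficientwise: for `b = 1` it is a cubic polynomial
in `a` whose leading coefficient `x³ - α` is zero and which vanishes at the distinct scalars
`0`, `1` and `ρ`. No further scalars are available when `F` has four elements. -/
theorem rel_coeffs {ρ : F} (h3 : (3 : F) ≠ 0) (hρ : ρ ^ 2 + ρ + 1 = 0) :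
    (c.x * c.x * c.y + c.x * c.y * c.x + c.y * c.x * c.x - c.r • (c.x * c.x) - c.e • c.x
      - c.β • 1 = 0) ∧
    (c.x * c.y * c.y + c.y * c.x * c.y + c.y * c.y * c.x - c.r • (c.x * c.y + c.y * c.x)
      - c.e • c.y - c.t • c.x - c.γ • 1 = 0) ∧
    (c.y ^ 3 - c.r • c.y ^ 2 - c.t • c.y - c.δ • 1 = 0) := by
  have h0 : c.y ^ 3 - c.r • c.y ^ 2 - c.t • c.y - c.δ • 1 = 0 := by simpa using c.rel 0 1
  have hx : c.x ^ 3 = c.α • (1 : c.Cliff) := by rw [c.x_pow_three, Algebra.algebraMap_eq_smul_one]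
  set A₂ := c.x * c.x * c.y + c.x * c.y * c.x + c.y * c.x * c.x - c.r • (c.x * c.x) - c.e • c.x
      - c.β • (1 : c.Cliff) with hA₂
  set A₁ := c.x * c.y * c.y + c.y * c.x * c.y + c.y * c.y * c.x - c.r • (c.x * c.y + c.y * c.x)
      - c.e • c.y - c.t • c.x - c.γ • (1 : c.Cliff) with hA₁
  have key (a : F) : a ^ 2 • A₂ + a • A₁ = 0 := by
    have h : a ^ 2 • A₂ + a • A₁ = ((a • c.x + (1 : F) • c.y) ^ 3
        - (c.r * 1) • (a • c.x + (1 : F) • c.y) ^ 2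
        - (c.e * a * 1 + c.t * 1 ^ 2) • (a • c.x + (1 : F) • c.y)
        - (c.α * a ^ 3 + c.β * a ^ 2 * 1 + c.γ * a * 1 ^ 2 + c.δ * 1 ^ 3) • (1 : c.Cliff))
        - a ^ 3 • (c.x ^ 3 - c.α • (1 : c.Cliff))
        - (c.y ^ 3 - c.r • c.y ^ 2 - c.t • c.y - c.δ • 1) := by
      rw [hA₂, hA₁]
      simp only [pow_succ, pow_zero, one_mul, add_mul, mul_add, smul_mul_assoc, mul_smul_comm,
        mul_assoc]
      module
    rw [h, c.rel, h0, hx, sub_self, smul_zero, sub_zero, sub_zero]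
  have h1 : A₁ = -A₂ := by
    have := key 1
    rwa [one_pow, one_smul, one_smul, add_comm, add_eq_zero_iff_eq_neg] at this
  -- If `ρ² = ρ`, then `ρ² + ρ + 1 = 0` forces `ρ = 1` and `3 = 0`.
  have hρ1 : ρ ^ 2 - ρ ≠ 0 := fun h ↦ h3 (by grind)
  have h2 : A₂ = 0 := by
    have : (ρ ^ 2 - ρ) • A₂ = 0 := by
      rw [← key ρ, h1]
      module
    rw [← one_smul F A₂, ← inv_mul_cancel₀ hρ1, mul_smul, this, smul_zero]
  exact ⟨h2, by rw [h1, h2, neg_zero], h0⟩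

/-- The relation of degree one in `y` determines the component of `y` that commutes with `x`. -/
theorem yComp_zero {ρ : F} (h3 : (3 : F) ≠ 0) (hα : c.α ≠ 0) (hρ : ρ ^ 2 + ρ + 1 = 0) :
    c.yComp ρ 0 = (3⁻¹ : F) • (c.r • (1 : c.Cliff) + c.e • c.xInv + c.β • c.xInv ^ 2) := by
  obtain ⟨h, -, -⟩ := c.rel_coeffs h3 hρ
  have h1 := c.x_mul_xInv hα
  have h1' (a : c.Cliff) : c.x * (c.xInv * a) = a := by rw [← mul_assoc, h1, one_mul]
  have := congrArg (· * (c.xInv * c.xInv)) h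
  simp only [sub_mul, add_mul, mul_assoc, smul_mul_assoc, h1, h1', mul_one, one_mul,
    zero_mul] at this
  simp only [yComp, pow_zero, mul_zero, one_smul, pow_two, mul_assoc]
  congr 1
  rw [← sub_eq_zero, ← this]
  abel

/-- The generators of `C_Φ` and the components of `y` form a Clifford triple. -/
theorem isCliffordTriple {ρ : F} (h3 : (3 : F) ≠ 0) (hα : c.α ≠ 0) (hρ : IsPrimitiveRoot ρ 3) :
    c.IsCliffordTriple ρ c.x c.y (c.yComp ρ 1) (c.yComp ρ 2) := by
  have hρ0 := sq_add_self_add_one hρ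
  obtain ⟨-, h1, h2⟩ := c.rel_coeffs h3 hρ0
  have hy : c.y = (3⁻¹ : F) • (c.r • (1 : c.Cliff) + c.e • (c.α⁻¹ • c.x ^ 2)
      + c.β • (c.α⁻¹ • c.x ^ 2) ^ 2) + c.yComp ρ 1 + c.yComp ρ 2 := by
    conv_lhs => rw [c.yComp_sum hρ h3, c.yComp_zero h3 hα hρ0]
    rfl
  refine ⟨c.x_pow_three, by simpa using c.yComp_mul_x hα hρ.pow_eq_one 1,
    c.yComp_mul_x hα hρ.pow_eq_one 2, hy, h1, h2, ?_⟩
  have hgen : Algebra.adjoin F {c.x, c.y} = ⊤ := by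
    have : Algebra.adjoin F (Set.range (FreeAlgebra.ι F (X := Fin 2))) = ⊤ :=
      FreeAlgebra.adjoin_range_ι F _
    have := congrArg (Subalgebra.map (RingQuot.mkAlgHom F (GenCliffordRel c.Phi))) this
    rw [AlgHom.map_adjoin, Algebra.map_top, (AlgHom.range_eq_top _).2
      (RingQuot.mkAlgHom_surjective F _)] at this
    rw [← this]
    congr 1
    ext a
    simp [Fin.exists_fin_two, x, y, GenClifford.gen, eq_comm]
  rw [← top_le_iff, ← hgen]
  refine Algebra.adjoin_le ?_
  have hx : c.x ∈ Algebra.adjoin F {c.x, c.yComp ρ 1, c.yComp ρ 2} :=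
    Algebra.subset_adjoin (by simp)
  have hy1 : c.yComp ρ 1 ∈ Algebra.adjoin F {c.x, c.yComp ρ 1, c.yComp ρ 2} :=
    Algebra.subset_adjoin (by simp)
  have hy2 : c.yComp ρ 2 ∈ Algebra.adjoin F {c.x, c.yComp ρ 1, c.yComp ρ 2} :=
    Algebra.subset_adjoin (by simp)
  rintro a (rfl | rfl)
  · exact hx
  · set B := Algebra.adjoin F {c.x, c.yComp ρ 1, c.yComp ρ 2}
    rw [hy]
    have hi := B.smul_mem (pow_mem hx 2) c.α⁻¹
    exact add_mem (add_mem (B.smul_mem (add_mem (add_mem (B.smul_mem (one_mem B) _)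
      (B.smul_mem hi _)) (B.smul_mem (pow_mem hi 2) _)) _) hy1) hy2

/-- The equation of `E` and its Weierstrass form, over any `F`-algebra. -/
theorem weierstrass_eq_aeval_curvePoly {ρ : F} {R : Type*} [CommRing R] [Algebra F R]
    (h3 : (3 : F) ≠ 0) (hα : c.α ≠ 0) (W S : R) :
    (algebraMap F R c.α * S) ^ 2
      + algebraMap F R (c.weierstrass ρ).a₁ * -(algebraMap F R c.α * W) * (algebraMap F R c.α * S)
      + algebraMap F R (c.weierstrass ρ).a₃ * (algebraMap F R c.α * S)
      - ((-(algebraMap F R c.α * W)) ^ 3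
        + algebraMap F R (c.weierstrass ρ).a₂ * (-(algebraMap F R c.α * W)) ^ 2
        + algebraMap F R (c.weierstrass ρ).a₄ * -(algebraMap F R c.α * W)
        + algebraMap F R (c.weierstrass ρ).a₆) =
      algebraMap F R c.α ^ 2 * MvPolynomial.aeval ![W, S] (c.curvePoly ρ) := by
  have h9 : (9 : F) ≠ 0 := by
    rw [show (9 : F) = 3 ^ 2 by norm_num]; exact pow_ne_zero _ h3
  have h27 : (27 : F) ≠ 0 := by
    rw [show (27 : F) = 3 ^ 3 by norm_num]; exact pow_ne_zero _ h3
  have h729 : (729 : F) ≠ 0 := by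
    rw [show (729 : F) = 3 ^ 6 by norm_num]; exact pow_ne_zero _ h3
  have e4 : ρ ^ 2 * (c.D₁ * c.D₂ / 9) = c.α * (ρ ^ 2 * (c.D₁ * c.D₂ / (9 * c.α))) := by field_simp
  have e6 : c.α * c.D₁ ^ 3 / 27 + c.D₂ ^ 3 / (729 * c.α) =
      c.α ^ 2 * (c.D₁ ^ 3 / (27 * c.α)) + c.α ^ 2 * (c.D₂ ^ 3 / (729 * c.α ^ 3)) := by
    field_simp
  simp only [weierstrass, e4, e6, curvePoly, map_add, map_sub, map_mul, map_pow, map_neg, map_zero,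
    MvPolynomial.aeval_X, MvPolynomial.algHom_C, Matrix.cons_val_zero, Matrix.cons_val_one]
  ring

/-- On a smooth curve the partial derivatives of the equation generate the unit ideal. -/
theorem exists_smooth {R : Type*} [CommRing R] [Algebra F R] {ρ : F} (h3 : (3 : F) ≠ 0)
    (hα : c.α ≠ 0) (hE : (c.weierstrass ρ).Δ ≠ 0) {W S : R}
    (hWS : MvPolynomial.aeval ![W, S] (c.curvePoly ρ) = 0) :
    ∃ a b : R, a * (algebraMap F R c.D - algebraMap F R (ρ ^ 2 * c.e) * W + 2 * S)
      + b * (3 * algebraMap F R c.α * W ^ 2 - algebraMap F R (ρ ^ 2 * c.e) * S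
        - algebraMap F R (ρ ^ 2 * (c.D₁ * c.D₂ / (9 * c.α)))) = 1 := by
  set P := algebraMap F R c.D - algebraMap F R (ρ ^ 2 * c.e) * W + 2 * S with hP
  set Q := 3 * algebraMap F R c.α * W ^ 2 - algebraMap F R (ρ ^ 2 * c.e) * S
        - algebraMap F R (ρ ^ 2 * (c.D₁ * c.D₂ / (9 * c.α))) with hQ
  rw [← Ideal.mem_span_pair, ← Ideal.eq_top_iff_one]
  by_contra hI
  -- Modulo a maximal ideal containing both derivatives, `(W, S)` would be a singular point.
  obtain ⟨M, hM, hIM⟩ := Ideal.exists_le_maximal _ hI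
  let _ : Field (R ⧸ M) := Ideal.Quotient.field M
  let f : R →ₐ[F] R ⧸ M := Ideal.Quotient.mkₐ F M
  have hfP : f P = 0 := Ideal.Quotient.eq_zero_iff_mem.2 (hIM (Ideal.subset_span (by simp)))
  have hfQ : f Q = 0 := Ideal.Quotient.eq_zero_iff_mem.2 (hIM (Ideal.subset_span (by simp)))
  simp only [hP, hQ, map_add, map_sub, map_mul, map_pow, AlgHom.commutes, map_ofNat] at hfP hfQ
  have h9 : (9 : F) ≠ 0 := by
    rw [show (9 : F) = 3 ^ 2 by norm_num]; exact pow_ne_zero _ h3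
  have e4 : ρ ^ 2 * (c.D₁ * c.D₂ / 9) = c.α * (ρ ^ 2 * (c.D₁ * c.D₂ / (9 * c.α))) := by field_simp
  have hΔ : ((c.weierstrass ρ).map (algebraMap F (R ⧸ M))).Δ ≠ 0 := by
    rw [WeierstrassCurve.map_Δ]
    simpa using hE
  have heq : ((c.weierstrass ρ).map (algebraMap F (R ⧸ M))).toAffine.Equation
      (-(algebraMap F _ c.α * f W)) (algebraMap F _ c.α * f S) := by
    rw [WeierstrassCurve.Affine.equation_iff']
    have hfE : MvPolynomial.aeval ![f W, f S] (c.curvePoly ρ) = 0 := by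
      rw [← map_zero f, ← hWS, MvPolynomial.comp_aeval_apply]
      congr 2
      ext i
      fin_cases i <;> rfl
    have := c.weierstrass_eq_aeval_curvePoly (ρ := ρ) h3 hα (f W) (f S)
    rw [hfE, mul_zero] at this
    exact this
  rw [WeierstrassCurve.Affine.equation_iff_nonsingular_of_Δ_ne_zero hΔ,
    WeierstrassCurve.Affine.nonsingular_iff'] at heq
  simp only [weierstrass, WeierstrassCurve.map, e4, map_neg, map_mul, map_pow, map_zero] at heq
  obtain ⟨-, h | h⟩ := heq
  · apply h
    linear_combination -algebraMap F _ c.α * hfQ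
  · apply h
    linear_combination algebraMap F _ c.α * hfP

end Presentation

/-! ### A matrix model over the function field of `E` -/

section Model

open Matrix

/-- The Cayley–Hamilton theorem for `3 × 3` matrices, with explicit coefficients. -/
theorem cayley_hamilton_three {L : Type*} [CommRing L] {M : Matrix (Fin 3) (Fin 3) L}
    {m₀₀ m₀₁ m₀₂ m₁₀ m₁₁ m₁₂ m₂₀ m₂₁ m₂₂ : L}
    (hM : M = !![m₀₀, m₀₁, m₀₂; m₁₀, m₁₁, m₁₂; m₂₀, m₂₁, m₂₂]) :
    M ^ 3 - (m₀₀ + m₁₁ + m₂₂) • M ^ 2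
      + (m₀₀ * m₁₁ - m₀₁ * m₁₀ + (m₀₀ * m₂₂ - m₀₂ * m₂₀) + (m₁₁ * m₂₂ - m₁₂ * m₂₁)) • M
      - (m₀₀ * m₁₁ * m₂₂ - m₀₀ * m₁₂ * m₂₁ - m₀₁ * m₁₀ * m₂₂ + m₀₁ * m₁₂ * m₂₀
        + m₀₂ * m₁₀ * m₂₁ - m₀₂ * m₁₁ * m₂₀) • (1 : Matrix (Fin 3) (Fin 3) L) = 0 := by
  subst hM
  ext i j
  fin_cases i <;> fin_cases j <;>
  · simp [pow_succ]
    ring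

/-- The identities behind the characteristic polynomial of the matrix model. With `f_i`, `n_i` the
values of `y₀` and `y₂y₁` at the three cube roots of `α`, the first six recover the coefficients
`r`, `e`, `-t`, `β`, `γ`, `δ` of `Φ`, and the last one is the norm of `y₂y₁`. Here `A = α`,
`i = 1/3` and `z` is the inverse of a cube root of `α`. -/
theorem modelCoeff_identities {L : Type*} [CommRing L] {A ρ z i r e t β γ δ D₁ D₂ D W : L}
    {f₀ f₁ f₂ n₀ n₁ n₂ : L}
    (hi : i * 3 = 1) (hρ : ρ ^ 2 + ρ + 1 = 0) (hz : A * z ^ 3 = 1)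
    (hD₁ : D₁ = γ + i * e * r - i * β ^ 2 * z ^ 3)
    (hD₂ : D₂ = e * β - 3 * A * t - A * r ^ 2)
    (hD : D = i ^ 3 * (e ^ 3 * z ^ 3 + β ^ 3 * z ^ 6 - 2 * r ^ 3) + i * β * D₁ * z ^ 3
      - i * r * t - δ)
    (hf₀ : f₀ = i * (r + e * z + β * z ^ 2))
    (hf₁ : f₁ = i * (r + e * (ρ ^ 2 * z) + β * (ρ ^ 2 * z) ^ 2))
    (hf₂ : f₂ = i * (r + e * (ρ * z) + β * (ρ * z) ^ 2))
    (hn₀ : n₀ = A * z ^ 2 * (W - (i * ρ ^ 2 * D₁ * z ^ 2 + i ^ 2 * D₂ * z ^ 4)))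
    (hn₁ : n₁ = A * (ρ ^ 2 * z) ^ 2 *
      (W - (i * ρ ^ 2 * D₁ * (ρ ^ 2 * z) ^ 2 + i ^ 2 * D₂ * (ρ ^ 2 * z) ^ 4)))
    (hn₂ : n₂ = A * (ρ * z) ^ 2 *
      (W - (i * ρ ^ 2 * D₁ * (ρ * z) ^ 2 + i ^ 2 * D₂ * (ρ * z) ^ 4))) :
    f₀ + f₁ + f₂ = r ∧
    A * z ^ 2 * (ρ * f₁ + ρ ^ 2 * f₂ + f₀) = e ∧
    f₀ * f₁ + f₀ * f₂ + f₁ * f₂ - n₀ - n₁ - n₂ = -t ∧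
    A ^ 2 * z ^ 4 * (ρ * f₂ + ρ ^ 2 * f₁ + f₀) = β ∧
    A * z ^ 2 * (f₁ * f₂ + ρ * f₀ * f₂ + ρ ^ 2 * f₀ * f₁ - n₂ - ρ * n₀ - ρ ^ 2 * n₁) = γ ∧
    f₀ * f₁ * f₂ - n₁ * f₂ - n₂ * f₀ - n₀ * f₁ + ρ ^ 2 * e * W - D = δ ∧
    n₀ * n₁ * n₂ = A * W ^ 3 - i ^ 3 * D₁ ^ 3 * z ^ 3 - i ^ 6 * D₂ ^ 3 * z ^ 9
      - ρ ^ 2 * (i ^ 2 * D₁ * D₂ * z ^ 3) * W := by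
  have hρ3 : ρ ^ 3 = 1 := by grind
  have hρ4 : ρ ^ 4 = ρ := by linear_combination ρ * hρ3
  have hf₁' : f₁ = i * (r + ρ ^ 2 * e * z + ρ * β * z ^ 2) := by
    rw [hf₁]; linear_combination i * β * z ^ 2 * hρ4
  have hf₂' : f₂ = i * (r + ρ * e * z + ρ ^ 2 * β * z ^ 2) := by
    rw [hf₂]; ring
  have hn₀' : n₀ = A * z ^ 2 * W - i * ρ ^ 2 * D₁ * z - i ^ 2 * D₂ * z ^ 3 := by
    rw [hn₀]; linear_combination (-i * ρ ^ 2 * D₁ * z - i ^ 2 * D₂ * z ^ 3) * hz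
  have hn₁' : n₁ = ρ * A * z ^ 2 * W - i * ρ * D₁ * z - i ^ 2 * D₂ * z ^ 3 := by
    rw [hn₁]; clear hD₁ hD₂ hD hf₀ hf₁ hf₂ hn₀ hn₁ hn₂ hf₁' hf₂' hn₀' hi
    grind
  have hn₂' : n₂ = ρ ^ 2 * A * z ^ 2 * W - i * D₁ * z - i ^ 2 * D₂ * z ^ 3 := by
    rw [hn₂]; clear hD₁ hD₂ hD hf₀ hf₁ hf₂ hn₀ hn₁ hn₂ hf₁' hf₂' hn₀' hi hn₁'
    grind
  clear hf₁ hf₂ hn₀ hn₁ hn₂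
  subst hf₀ hf₁' hf₂' hn₀' hn₁' hn₂'
  refine ⟨?_, ?_, ?_, ?_, ?_, ?_, ?_⟩
  · clear hD₁ hD₂ hD
    grind
  · clear hD₁ hD₂ hD
    grind
  · clear hD
    subst hD₁ hD₂
    grind
  · clear hD₁ hD₂ hD
    grind
  · clear hD
    subst hD₁ hD₂
    grind
  · subst hD hD₁ hD₂
    grind
  · clear hD₁ hD₂ hD
    grind

variable {F L : Type*} [Field F] [Field L] [Algebra F L] (c : CubicCoeffs F) (ρ : F) (l W S : L)

/-- The entry of `y₂y₁` at the eigenvalue `l` of `x`, as a function of `z = l⁻¹`. -/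
def modelCoeff (z : L) : L := algebraMap F L c.α * z ^ 2 * (W - c.wCoeff ρ z)

/-- The image of `x` in the matrix model: its eigenvalues are the cube roots of `α`. -/
def modelX : Matrix (Fin 3) (Fin 3) L :=
  diagonal fun i ↦ algebraMap F L ρ ^ (i : ℕ) * l

/-- The image of `y` in the matrix model. -/
def modelY : Matrix (Fin 3) (Fin 3) L :=
  !![c.y₀Coeff l⁻¹, 1, c.modelCoeff ρ W l⁻¹ / S;
     c.modelCoeff ρ W (algebraMap F L ρ ^ 2 * l⁻¹), c.y₀Coeff (algebraMap F L ρ ^ 2 * l⁻¹), 1;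
     S, c.modelCoeff ρ W (algebraMap F L ρ * l⁻¹), c.y₀Coeff (algebraMap F L ρ * l⁻¹)]

variable {c ρ l W S}

/-- The matrices of the model satisfy the relations of `C_Φ`: the trace, the second coefficient and
the determinant of `aX + bY` are those of `Φ(Z, a, b)`, and the Cayley–Hamilton theorem applies. The
equation of `E` enters through the determinant. -/
theorem model_rel (h3 : (3 : F) ≠ 0) (hα : c.α ≠ 0) (hρ : ρ ^ 2 + ρ + 1 = 0)
    (hl : l ^ 3 = algebraMap F L c.α) (hS : S ≠ 0)
    (hWS : MvPolynomial.aeval ![W, S] (c.curvePoly ρ) = 0) (a b : F) :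
    (a • modelX ρ l + b • c.modelY ρ l W S) ^ 3
      - (c.r * b) • (a • modelX ρ l + b • c.modelY ρ l W S) ^ 2
      - (c.e * a * b + c.t * b ^ 2) • (a • modelX ρ l + b • c.modelY ρ l W S)
      - (c.α * a ^ 3 + c.β * a ^ 2 * b + c.γ * a * b ^ 2 + c.δ * b ^ 3) •
        (1 : Matrix (Fin 3) (Fin 3) L) = 0 := by
  have hi := algebraMap_inv_three (K := L) h3
  have hρ' : algebraMap F L ρ ^ 2 + algebraMap F L ρ + 1 = 0 := by
    simpa using congrArg (algebraMap F L) hρ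
  have hl0 : l ≠ 0 := by
    rintro rfl
    exact hα (by simpa using hl.symm)
  have hz : algebraMap F L c.α * l⁻¹ ^ 3 = 1 := by
    rw [← hl, ← mul_pow, mul_inv_cancel₀ hl0, one_pow]
  have hz1 : l * l⁻¹ = 1 := mul_inv_cancel₀ hl0
  have hS1 : S * S⁻¹ = 1 := mul_inv_cancel₀ hS
  have hz' : algebraMap F L c.α⁻¹ = l⁻¹ ^ 3 := by
    rw [map_inv₀, ← hl, inv_pow]
  have hD1 := algebraMap_D₁ c hα hz
  have hD2 := c.algebraMap_D₂ (K := L)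
  have hD := algebraMap_D c hα hz
  have e1 : c.D₁ ^ 3 / (27 * c.α) = 3⁻¹ ^ 3 * c.D₁ ^ 3 * c.α⁻¹ := by
    rw [show (27 : F) = 3 ^ 3 by norm_num]; field_simp
  have e2 : c.D₂ ^ 3 / (729 * c.α ^ 3) = 3⁻¹ ^ 6 * c.D₂ ^ 3 * c.α⁻¹ ^ 3 := by
    rw [show (729 : F) = 3 ^ 6 by norm_num]; field_simp
  have e3 : c.D₁ * c.D₂ / (9 * c.α) = 3⁻¹ ^ 2 * c.D₁ * c.D₂ * c.α⁻¹ := by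
    rw [show (9 : F) = 3 ^ 2 by norm_num]; field_simp
  simp only [curvePoly, map_add, map_sub, map_mul, map_pow, MvPolynomial.aeval_X,
    MvPolynomial.algHom_C, Matrix.cons_val_zero, Matrix.cons_val_one, e1, e2, e3, hz'] at hWS
  obtain ⟨c1, c2, c3, c4, c5, c6, c7⟩ := modelCoeff_identities (W := W)
    (f₀ := c.y₀Coeff l⁻¹) (f₁ := c.y₀Coeff (algebraMap F L ρ ^ 2 * l⁻¹))
    (f₂ := c.y₀Coeff (algebraMap F L ρ * l⁻¹)) (n₀ := c.modelCoeff ρ W l⁻¹)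
    (n₁ := c.modelCoeff ρ W (algebraMap F L ρ ^ 2 * l⁻¹))
    (n₂ := c.modelCoeff ρ W (algebraMap F L ρ * l⁻¹)) hi hρ' hz hD1 hD2 hD rfl rfl rfl rfl rfl rfl
  have hlz : algebraMap F L c.α * l⁻¹ ^ 2 = l := by
    linear_combination l * hz - algebraMap F L c.α * l⁻¹ ^ 2 * hz1
  have hlz' : algebraMap F L c.α ^ 2 * l⁻¹ ^ 4 = l ^ 2 := by
    linear_combination (algebraMap F L c.α * l⁻¹ ^ 2 + l) * hlz
  rw [hlz] at c2 c5
  rw [hlz'] at c4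
  have hmat : a • modelX ρ l + b • c.modelY ρ l W S =
      !![algebraMap F L a * l + algebraMap F L b * c.y₀Coeff l⁻¹, algebraMap F L b,
          algebraMap F L b * (c.modelCoeff ρ W l⁻¹ * S⁻¹);
        algebraMap F L b * c.modelCoeff ρ W (algebraMap F L ρ ^ 2 * l⁻¹),
          algebraMap F L a * (algebraMap F L ρ * l)
            + algebraMap F L b * c.y₀Coeff (algebraMap F L ρ ^ 2 * l⁻¹), algebraMap F L b;
        algebraMap F L b * S, algebraMap F L b * c.modelCoeff ρ W (algebraMap F L ρ * l⁻¹),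
          algebraMap F L a * (algebraMap F L ρ ^ 2 * l)
            + algebraMap F L b * c.y₀Coeff (algebraMap F L ρ * l⁻¹)] := by
    ext i j
    fin_cases i <;> fin_cases j <;> simp [modelX, modelY, div_eq_mul_inv] <;>
      simp only [Algebra.smul_def, mul_one]
  have hM := cayley_hamilton_three hmat
  clear hmat
  generalize a • modelX ρ l + b • c.modelY ρ l W S = M at hM ⊢
  have hρ3 : algebraMap F L ρ ^ 3 = 1 := by linear_combination (algebraMap F L ρ - 1) * hρ'
  generalize c.modelCoeff ρ W l⁻¹ = n₀ at *
  generalize c.modelCoeff ρ W (algebraMap F L ρ ^ 2 * l⁻¹) = n₁ at *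
  generalize c.modelCoeff ρ W (algebraMap F L ρ * l⁻¹) = n₂ at *
  generalize c.y₀Coeff l⁻¹ = f₀ at *
  generalize c.y₀Coeff (algebraMap F L ρ ^ 2 * l⁻¹) = f₁ at *
  generalize c.y₀Coeff (algebraMap F L ρ * l⁻¹) = f₂ at *
  have c8 : n₀ * n₁ * n₂ * S⁻¹ =
      algebraMap F L ρ ^ 2 * algebraMap F L c.e * W - algebraMap F L c.D - S := by
    linear_combination S⁻¹ * c7 + S⁻¹ * hWS + (algebraMap F L ρ ^ 2 * algebraMap F L c.e * W
      - algebraMap F L c.D - S) * hS1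
  rw [← algebraMap_smul L _ (M ^ 2), ← algebraMap_smul L _ M,
    ← algebraMap_smul L _ (1 : Matrix (Fin 3) (Fin 3) L)]
  simp only [map_add, map_mul, map_pow]
  generalize algebraMap F L a = a' at *
  generalize algebraMap F L b = b' at *
  have T : a' * l + b' * f₀ + (a' * (algebraMap F L ρ * l) + b' * f₁)
      + (a' * (algebraMap F L ρ ^ 2 * l) + b' * f₂) = algebraMap F L c.r * b' := by
    linear_combination b' * c1 + a' * l * hρ'
  have E2 : (a' * l + b' * f₀) * (a' * (algebraMap F L ρ * l) + b' * f₁)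
      + (a' * l + b' * f₀) * (a' * (algebraMap F L ρ ^ 2 * l) + b' * f₂)
      + (a' * (algebraMap F L ρ * l) + b' * f₁) * (a' * (algebraMap F L ρ ^ 2 * l) + b' * f₂)
      - b' ^ 2 * (n₀ * S⁻¹ * S + n₁ + n₂) =
      -(algebraMap F L c.e * a' * b' + algebraMap F L c.t * b' ^ 2) := by
    linear_combination b' ^ 2 * c3 - a' * b' * c2 + a' ^ 2 * l ^ 2 * algebraMap F L ρ * hρ'
      + a' * b' * l * (f₀ + f₁ + f₂) * hρ'
      - b' ^ 2 * n₀ * hS1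
  have Dt : (a' * l + b' * f₀) * (a' * (algebraMap F L ρ * l) + b' * f₁)
        * (a' * (algebraMap F L ρ ^ 2 * l) + b' * f₂)
      - b' ^ 2 * (n₁ * (a' * (algebraMap F L ρ ^ 2 * l) + b' * f₂) + n₂ * (a' * l + b' * f₀)
        + n₀ * S⁻¹ * S * (a' * (algebraMap F L ρ * l) + b' * f₁))
      + b' ^ 3 * (S + n₀ * n₁ * n₂ * S⁻¹) = algebraMap F L c.α * a' ^ 3
      + algebraMap F L c.β * a' ^ 2 * b' + algebraMap F L c.γ * a' * b' ^ 2
      + algebraMap F L c.δ * b' ^ 3 := by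
    linear_combination a' ^ 3 * hl + a' ^ 2 * b' * c4 + a' * b' ^ 2 * c5 + b' ^ 3 * c6 + b' ^ 3 * c8
      + (a' ^ 3 * l ^ 3 + a' ^ 2 * b' * f₀ * l ^ 2) * hρ3
      - b' ^ 2 * n₀ * (a' * (algebraMap F L ρ * l) + b' * f₁) * hS1
  linear_combination (norm := module) hM + T • M ^ 2 - E2 • M + Dt • (1 : Matrix (Fin 3) (Fin 3) L)

variable (c ρ l W S) in
/-- The matrix representation of `C_Φ` attached to a point `(W, S)` of `E` and a cube root `l`
of `α`. -/
def modelHom (h : ∀ a b : F, (a • modelX ρ l + b • c.modelY ρ l W S) ^ 3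
      - (c.r * b) • (a • modelX ρ l + b • c.modelY ρ l W S) ^ 2
      - (c.e * a * b + c.t * b ^ 2) • (a • modelX ρ l + b • c.modelY ρ l W S)
      - (c.α * a ^ 3 + c.β * a ^ 2 * b + c.γ * a * b ^ 2 + c.δ * b ^ 3) •
        (1 : Matrix (Fin 3) (Fin 3) L) = 0) :
    c.Cliff →ₐ[F] Matrix (Fin 3) (Fin 3) L :=
  RingQuot.liftAlgHom F ⟨FreeAlgebra.lift F ![modelX ρ l, c.modelY ρ l W S], by
    rintro _ _ ⟨v⟩
    rw [map_zero, map_aeval_Phi]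
    simpa using h (v 0) (v 1)⟩

/-- In the representation attached to a point `(W, S)` of `E` with `S ≠ 0`, the image of `y₁` is a
weighted cyclic permutation matrix with cube `S`. The image of `y₂y₁` is diagonal, with the values
of `x(W - …)` at the eigenvalues of `x` as its entries, so `w` acts as `W`. -/
theorem exists_model (h3 : (3 : F) ≠ 0) (hα : c.α ≠ 0) (hρ : ρ ^ 2 + ρ + 1 = 0)
    (hl : l ^ 3 = algebraMap F L c.α) (hS : S ≠ 0)
    (hWS : MvPolynomial.aeval ![W, S] (c.curvePoly ρ) = 0) :
    ∃ φ : c.Cliff →ₐ[F] Matrix (Fin 3) (Fin 3) L,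
      φ (c.yComp ρ 1 ^ 3) = algebraMap L _ S ∧ φ (c.w ρ) = algebraMap L _ W := by
  let φ := modelHom c ρ l W S (model_rel h3 hα hρ hl hS hWS)
  have hi := algebraMap_inv_three (K := L) h3
  have hρ' : algebraMap F L ρ ^ 2 + algebraMap F L ρ + 1 = 0 := by
    simpa using congrArg (algebraMap F L) hρ
  have hl0 : l ≠ 0 := by
    rintro rfl
    exact hα (by simpa using hl.symm)
  have hρ3 : algebraMap F L ρ ^ 3 = 1 := by linear_combination (algebraMap F L ρ - 1) * hρ'
  have hz1 : l * l⁻¹ = 1 := mul_inv_cancel₀ hl0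
  have hz' : algebraMap F L c.α⁻¹ = l⁻¹ ^ 3 := by
    rw [map_inv₀, ← hl, inv_pow]
  have hx : φ c.x = modelX ρ l := by
    simp [φ, modelHom, x, GenClifford.gen]
  have hy : φ c.y = c.modelY ρ l W S := by
    simp [φ, modelHom, y, GenClifford.gen]
  have hxi : φ c.xInv = diagonal ![l⁻¹, algebraMap F L ρ ^ 2 * l⁻¹, algebraMap F L ρ * l⁻¹] := by
    rw [xInv, map_smul, map_pow, hx, modelX, diagonal_pow, ← diagonal_smul]
    congr 1
    ext i
    fin_cases i <;> simp [Algebra.smul_def, hz', -map_inv₀] <;> field_simp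
    linear_combination algebraMap F L ρ * hρ3
  have hyk (k : ℕ) (i j : Fin 3) : φ (c.yComp ρ k) i j =
      algebraMap F L 3⁻¹ * c.modelY ρ l W S i j * (1 + algebraMap F L ρ ^ (k + i)
        * (l * ![l⁻¹, algebraMap F L ρ ^ 2 * l⁻¹, algebraMap F L ρ * l⁻¹] j)
      + algebraMap F L ρ ^ (2 * (k + i))
        * (l * ![l⁻¹, algebraMap F L ρ ^ 2 * l⁻¹, algebraMap F L ρ * l⁻¹] j) ^ 2) := by
    simp only [yComp, map_smul, map_add, map_mul, map_pow, hx, hy, hxi, modelX, diagonal_pow,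
      Matrix.smul_apply, Matrix.add_apply, mul_diagonal, diagonal_mul, Pi.pow_apply]
    simp only [Algebra.smul_def, map_pow]
    ring
  have hy1 : φ (c.yComp ρ 1) = !![0, 1, 0; 0, 0, 1; S, 0, 0] := by
    ext i j
    rw [hyk]
    fin_cases i <;> fin_cases j <;> simp [modelY, -map_inv₀] <;> grind
  have hy2 : φ (c.yComp ρ 2) = !![0, 0, c.modelCoeff ρ W l⁻¹ / S;
      c.modelCoeff ρ W (algebraMap F L ρ ^ 2 * l⁻¹), 0, 0;
      0, c.modelCoeff ρ W (algebraMap F L ρ * l⁻¹), 0] := by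
    ext i j
    rw [hyk]
    fin_cases i <;> fin_cases j <;> simp [modelY, -map_inv₀] <;> grind
  refine ⟨φ, ?_, ?_⟩
  · rw [map_pow, hy1]
    ext i j
    fin_cases i <;> fin_cases j <;> simp [pow_succ, mul_apply, Fin.sum_univ_three,
      algebraMap_matrix_apply]
  · have hyy : !![0, 0, c.modelCoeff ρ W l⁻¹ / S;
        c.modelCoeff ρ W (algebraMap F L ρ ^ 2 * l⁻¹), 0, 0;
        0, c.modelCoeff ρ W (algebraMap F L ρ * l⁻¹), 0] * !![0, 1, 0; 0, 0, 1; S, 0, 0] =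
        diagonal ![c.modelCoeff ρ W l⁻¹, c.modelCoeff ρ W (algebraMap F L ρ ^ 2 * l⁻¹),
          c.modelCoeff ρ W (algebraMap F L ρ * l⁻¹)] := by
      ext i j
      fin_cases i <;> fin_cases j <;> simp [hS]
    have hz : algebraMap F L c.α * l⁻¹ ^ 3 = 1 := by
      rw [← hl, ← mul_pow, hz1, one_pow]
    have e1 : c.D₁ / (3 * c.α) = 3⁻¹ * c.D₁ * c.α⁻¹ := by field_simp
    have e2 : c.D₂ / (9 * c.α) = 3⁻¹ ^ 2 * c.D₂ * c.α⁻¹ := by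
      rw [show (9 : F) = 3 ^ 2 by norm_num]; field_simp
    rw [w, map_add, map_add, map_mul, map_mul, map_smul, map_smul, hxi, hy1, hy2, hx, mul_assoc,
      hyy, modelX, diagonal_mul_diagonal, ← diagonal_smul, ← diagonal_smul, diagonal_add,
      diagonal_add, algebraMap_eq_diagonal, e1, e2]
    congr 1
    ext i
    simp only [Pi.smul_apply, Algebra.smul_def, map_mul, map_pow, hz', modelCoeff, wCoeff]
    clear hyy hy1 hy2 hyk hxi hy hx φ
    generalize l⁻¹ = z at *
    fin_cases i <;> simp [-map_inv₀] <;> grind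

end Model

/-! ### The coordinate ring of `E` and the center -/

section Curve

variable {F : Type*} [Field F] (c : CubicCoeffs F) {ρ : F}

/-- A point `(W, S)` of `E` over `R` is a homomorphism from `F[E]` to `R`. -/
theorem exists_coordRing_algHom {R : Type*} [CommRing R] [Algebra F R] {W S : R}
    (h : MvPolynomial.aeval ![W, S] (c.curvePoly ρ) = 0) :
    ∃ f : c.CoordRing ρ →ₐ[F] R, f (Ideal.Quotient.mk _ (MvPolynomial.X 0)) = W ∧
      f (Ideal.Quotient.mk _ (MvPolynomial.X 1)) = S :=
  ⟨Ideal.Quotient.liftₐ _ (MvPolynomial.aeval ![W, S]) fun a ha ↦ by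
    obtain ⟨b, rfl⟩ := Ideal.mem_span_singleton.1 ha
    rw [map_mul, h, zero_mul], MvPolynomial.aeval_X ![W, S] 0, MvPolynomial.aeval_X ![W, S] 1⟩

variable {c} in
theorem coordRing_algHom_ext {A : Type*} [Semiring A] [Algebra F A] {f g : c.CoordRing ρ →ₐ[F] A}
    (h₀ : f (Ideal.Quotient.mk _ (MvPolynomial.X 0)) = g (Ideal.Quotient.mk _ (MvPolynomial.X 0)))
    (h₁ : f (Ideal.Quotient.mk _ (MvPolynomial.X 1)) = g (Ideal.Quotient.mk _ (MvPolynomial.X 1))) :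
    f = g := by
  refine Ideal.Quotient.algHom_ext _ (MvPolynomial.algHom_ext fun i ↦ ?_)
  fin_cases i
  exacts [h₀, h₁]

theorem aeval_coordRing {R : Type*} [CommRing R] [Algebra F R] (f : c.CoordRing ρ →ₐ[F] R) :
    MvPolynomial.aeval ![f (Ideal.Quotient.mk _ (MvPolynomial.X 0)),
      f (Ideal.Quotient.mk _ (MvPolynomial.X 1))] (c.curvePoly ρ) = 0 := by
  have : MvPolynomial.aeval ![f (Ideal.Quotient.mk _ (MvPolynomial.X 0)),
      f (Ideal.Quotient.mk _ (MvPolynomial.X 1))] =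
        f.comp (Ideal.Quotient.mkₐ F (Ideal.span {c.curvePoly ρ})) := by
    ext i
    fin_cases i <;> simp
  have h0 : Ideal.Quotient.mk (Ideal.span {c.curvePoly ρ}) (c.curvePoly ρ) = 0 :=
    Ideal.Quotient.eq_zero_iff_mem.2 (Ideal.subset_span rfl)
  rw [this, AlgHom.comp_apply, Ideal.Quotient.mkₐ_eq_mk, h0, map_zero]

theorem coordRing_apply_mem {A : Type*} [Semiring A] [Algebra F A] (f : c.CoordRing ρ →ₐ[F] A)
    {B : Subalgebra F A} (h₀ : f (Ideal.Quotient.mk _ (MvPolynomial.X 0)) ∈ B)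
    (h₁ : f (Ideal.Quotient.mk _ (MvPolynomial.X 1)) ∈ B) (a : c.CoordRing ρ) : f a ∈ B := by
  obtain ⟨p, rfl⟩ := Ideal.Quotient.mk_surjective a
  induction p using MvPolynomial.induction_on with
  | C k => exact (f.commutes k).symm ▸ B.algebraMap_mem k
  | add p q hp hq =>
    rw [map_add, map_add]
    exact B.add_mem hp hq
  | mul_X p i hp =>
    rw [map_mul, map_mul]
    refine B.mul_mem hp ?_
    fin_cases i
    exacts [h₀, h₁]

open Polynomial in
/-- The bivariate Weierstrass polynomial at the point `(i X, v)`. -/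
theorem eval₂_weierstrass_polynomial {R : Type*} [CommRing R] [Algebra F R]
    (V : WeierstrassCurve.Affine F) (i : F[X] →ₐ[F] R) (v : R) :
    V.polynomial.eval₂ (i : F[X] →+* R) v =
      v ^ 2 + algebraMap F R V.a₁ * i X * v + algebraMap F R V.a₃ * v
      - (i X ^ 3 + algebraMap F R V.a₂ * i X ^ 2 + algebraMap F R V.a₄ * i X
        + algebraMap F R V.a₆) := by
  have hi (k : F) : i (C k) = algebraMap F R k := i.commutes k
  simp only [WeierstrassCurve.Affine.polynomial, eval₂_add, eval₂_sub, eval₂_mul, eval₂_pow,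
    eval₂_X, eval₂_C, RingHom.coe_coe, map_add, map_mul, map_pow, hi]
  ring

open Polynomial in
/-- The coordinates `X = -αR`, `Y = αS` embed `F[E]` in the coordinate ring of its Weierstrass form;
the inverse substitution is a left inverse. -/
theorem exists_coordRing_injective (h3 : (3 : F) ≠ 0) (hα : c.α ≠ 0) :
    ∃ g : c.CoordRing ρ →ₐ[F] (c.weierstrass ρ).toAffine.CoordinateRing,
      Function.Injective g ∧ g (Ideal.Quotient.mk _ (MvPolynomial.X 1)) ≠ 0 := by
  set V := (c.weierstrass ρ).toAffine with hV
  let X' : V.CoordinateRing := algebraMap F[X] _ X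
  let Y' : V.CoordinateRing := AdjoinRoot.root V.polynomial
  have hαα : algebraMap F V.CoordinateRing c.α * algebraMap F V.CoordinateRing c.α⁻¹ = 1 := by
    rw [← map_mul, mul_inv_cancel₀ hα, map_one]
  have hXY : Y' ^ 2 + algebraMap F _ V.a₁ * X' * Y' + algebraMap F _ V.a₃ * Y'
      - (X' ^ 3 + algebraMap F _ V.a₂ * X' ^ 2 + algebraMap F _ V.a₄ * X' + algebraMap F _ V.a₆)
      = 0 := by
    exact (eval₂_weierstrass_polynomial V (IsScalarTower.toAlgHom F F[X] V.CoordinateRing)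
      Y').symm.trans (AdjoinRoot.eval₂_root V.polynomial)
  let W₀ : V.CoordinateRing := -(algebraMap F _ c.α⁻¹ * X')
  let S₀ : V.CoordinateRing := algebraMap F _ c.α⁻¹ * Y'
  have hW₀ : -(algebraMap F _ c.α * W₀) = X' := by
    linear_combination X' * hαα
  have hS₀ : algebraMap F _ c.α * S₀ = Y' := by
    linear_combination Y' * hαα
  have hE : MvPolynomial.aeval ![W₀, S₀] (c.curvePoly ρ) = 0 := by
    have := c.weierstrass_eq_aeval_curvePoly (ρ := ρ) h3 hα W₀ S₀
    rw [hW₀, hS₀] at this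
    have h := hXY.symm.trans this
    linear_combination (-algebraMap F _ c.α⁻¹ ^ 2) * h
      - (algebraMap F V.CoordinateRing c.α * algebraMap F V.CoordinateRing c.α⁻¹ + 1)
        * MvPolynomial.aeval ![W₀, S₀] (c.curvePoly ρ) * hαα
  obtain ⟨g, hgr, hgs⟩ := c.exists_coordRing_algHom hE
  let r : c.CoordRing ρ := Ideal.Quotient.mk _ (MvPolynomial.X 0)
  let s : c.CoordRing ρ := Ideal.Quotient.mk _ (MvPolynomial.X 1)
  have hrs : MvPolynomial.aeval ![r, s] (c.curvePoly ρ) = 0 := c.aeval_coordRing (AlgHom.id F _)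
  let h : V.CoordinateRing →ₐ[F] c.CoordRing ρ :=
    AdjoinRoot.liftAlgHom V.polynomial (aeval (-(algebraMap F _ c.α * r)))
      (algebraMap F _ c.α * s) (by
        have := c.weierstrass_eq_aeval_curvePoly (ρ := ρ) h3 hα r s
        rw [hrs, mul_zero] at this
        rw [← this, eval₂_weierstrass_polynomial, aeval_X])
  have hhX : h X' = -(algebraMap F _ c.α * r) := by
    simp [h, X']
  have hhY : h Y' = algebraMap F _ c.α * s := by
    simp [h, Y']
  have hαα' : algebraMap F (c.CoordRing ρ) c.α * algebraMap F (c.CoordRing ρ) c.α⁻¹ = 1 := by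
    rw [← map_mul, mul_inv_cancel₀ hα, map_one]
  have hhg : h.comp g = AlgHom.id F _ := by
    refine coordRing_algHom_ext ?_ ?_
    · change h (g r) = r
      rw [hgr, map_neg, map_mul, h.commutes, hhX]
      linear_combination r * hαα'
    · change h (g s) = s
      rw [hgs, map_mul, h.commutes, hhY]
      linear_combination s * hαα'
  refine ⟨g, Function.LeftInverse.injective (g := h) (DFunLike.congr_fun hhg), ?_⟩
  intro h0
  apply WeierstrassCurve.Affine.CoordinateRing.YClass_ne_zero (W' := V) 0
  have h1 : S₀ = 0 := hgs.symm.trans h0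
  rw [WeierstrassCurve.Affine.CoordinateRing.YClass, map_zero, sub_zero]
  change Y' = 0
  rw [← hS₀, h1, mul_zero]

end Curve

universe u in
/-- The matrix model at the generic point of `E`, over an algebraic closure of the function field,
where `α` has a cube root. -/
theorem exists_coordRing_model {F : Type u} [Field F] (c : CubicCoeffs F) {ρ : F}
    (h3 : (3 : F) ≠ 0) (hα : c.α ≠ 0) (hρ : ρ ^ 2 + ρ + 1 = 0) :
    ∃ (L : Type u) (_ : Field L) (_ : Algebra F L) (g : c.CoordRing ρ →ₐ[F] L)
      (φ : c.Cliff →ₐ[F] Matrix (Fin 3) (Fin 3) L), Function.Injective g ∧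
      g (Ideal.Quotient.mk _ (MvPolynomial.X 1)) ≠ 0 ∧
      φ (c.w ρ) = algebraMap L _ (g (Ideal.Quotient.mk _ (MvPolynomial.X 0))) ∧
      φ (c.yComp ρ 1 ^ 3) = algebraMap L _ (g (Ideal.Quotient.mk _ (MvPolynomial.X 1))) := by
  obtain ⟨g₀, hg₀, hS₀⟩ := c.exists_coordRing_injective (ρ := ρ) h3 hα
  let V := (c.weierstrass ρ).toAffine
  let L := AlgebraicClosure V.FunctionField
  let _ : Algebra F L := ((algebraMap V.FunctionField L).comp
    ((algebraMap V.CoordinateRing V.FunctionField).comp (algebraMap F V.CoordinateRing))).toAlgebra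
  let i : V.CoordinateRing →ₐ[F] L :=
    { (algebraMap V.FunctionField L).comp (algebraMap V.CoordinateRing V.FunctionField) with
      commutes' := fun _ ↦ rfl }
  have hi : Function.Injective i :=
    (algebraMap V.FunctionField L).injective.comp (IsFractionRing.injective _ _)
  let g := i.comp g₀
  have hg : Function.Injective g := hi.comp hg₀
  have hS : g (Ideal.Quotient.mk _ (MvPolynomial.X 1)) ≠ 0 :=
    fun h ↦ hS₀ (hi (h.trans (map_zero i).symm))
  obtain ⟨l, hl⟩ := IsAlgClosed.exists_pow_nat_eq (algebraMap F L c.α) (by norm_num : 0 < 3)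
  obtain ⟨φ, h1, h2⟩ := exists_model h3 hα hρ hl hS (c.aeval_coordRing g)
  exact ⟨L, inferInstance, inferInstance, g, φ, hg, hS, h2, h1⟩

/-- The matrix model over the function field separates the elements of `F[E]`. -/
theorem coordRing_algHom_injective {F : Type*} [Field F] (c : CubicCoeffs F) {ρ : F}
    (h3 : (3 : F) ≠ 0) (hα : c.α ≠ 0) (hρ : ρ ^ 2 + ρ + 1 = 0) {f : c.CoordRing ρ →ₐ[F] c.Cliff}
    (h₀ : f (Ideal.Quotient.mk _ (MvPolynomial.X 0)) = c.w ρ)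
    (h₁ : f (Ideal.Quotient.mk _ (MvPolynomial.X 1)) = c.yComp ρ 1 ^ 3) :
    Function.Injective f := by
  obtain ⟨L, _, _, g, φ, hg, -, hφw, hφs⟩ := c.exists_coordRing_model h3 hα hρ
  have hφ : φ.comp f = (IsScalarTower.toAlgHom F L (Matrix (Fin 3) (Fin 3) L)).comp g :=
    coordRing_algHom_ext ((congrArg φ h₀).trans hφw) ((congrArg φ h₁).trans hφs)
  refine Function.Injective.of_comp (f := φ) ?_
  have : φ ∘ f = algebraMap L (Matrix (Fin 3) (Fin 3) L) ∘ g := funext (DFunLike.congr_fun hφ)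
  rw [this]
  exact (algebraMap L (Matrix (Fin 3) (Fin 3) L)).injective.comp hg

/-- `F[E]` maps onto the center of `C_Φ`. -/
theorem coordRing_algHom_surjective {F : Type*} [Field F] (c : CubicCoeffs F) {ρ : F}
    (h3 : (3 : F) ≠ 0) (hα : c.α ≠ 0) (hρ : IsPrimitiveRoot ρ 3) (hE : (c.weierstrass ρ).Δ ≠ 0)
    {f : c.CoordRing ρ →ₐ[F] Subalgebra.center F c.Cliff}
    (h₀ : (f (Ideal.Quotient.mk _ (MvPolynomial.X 0)) : c.Cliff) = c.w ρ)
    (h₁ : (f (Ideal.Quotient.mk _ (MvPolynomial.X 1)) : c.Cliff) = c.yComp ρ 1 ^ 3) :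
    Function.Surjective f := by
  have t := c.isCliffordTriple h3 hα hρ
  let _ : Algebra (c.CoordRing ρ) c.Cliff :=
    ((algebraMap (Subalgebra.center F c.Cliff) c.Cliff).comp f.toRingHom).toAlgebra'
      fun a b ↦ Algebra.commutes (f a) b
  have : IsScalarTower F (c.CoordRing ρ) c.Cliff := by
    refine ⟨fun a z b ↦ ?_⟩
    change (f (a • z) : c.Cliff) * b = a • ((f z : c.Cliff) * b)
    rw [map_smul]
    exact smul_mul_assoc a (f z : c.Cliff) b
  rintro ⟨z, hz⟩
  obtain ⟨a, ha⟩ := (t.center_and_azumaya h3 hα (sq_add_self_add_one hρ) h₀ h₁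
    (c.exists_smooth h3 hα hE (c.aeval_coordRing (AlgHom.id F _)))).1 z hz
  exact ⟨a, Subtype.ext ha⟩

end CubicCoeffs

open CubicCoeffs in
theorem mainTheorem2 {F : Type*} [Field F] (hchar : ringChar F ≠ 3)
    (ρ : F) (hρ : IsPrimitiveRoot ρ 3)
    (c : CubicCoeffs F) (hα : c.α ≠ 0)
    (hE : (c.weierstrass ρ).Δ ≠ 0) :
    Subalgebra.center F c.Cliff = Algebra.adjoin F {c.yComp ρ 1 ^ 3, c.w ρ} ∧
    (∃ ψ : c.CoordRing ρ ≃ₐ[F] Subalgebra.center F c.Cliff,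
      (ψ (Ideal.Quotient.mk _ (MvPolynomial.X 0)) : c.Cliff) = c.w ρ ∧
      (ψ (Ideal.Quotient.mk _ (MvPolynomial.X 1)) : c.Cliff) = c.yComp ρ 1 ^ 3) ∧
    (c.D ≠ 0 →
      IsField (AdjoinRoot (Polynomial.X ^ 3 - Polynomial.C c.α)) →
        IsAzumaya (Subalgebra.center F c.Cliff) c.Cliff ∧
        ∀ p : PrimeSpectrum (Subalgebra.center F c.Cliff),
          Module.rankAtStalk (R := Subalgebra.center F c.Cliff) c.Cliff p = 9) := by
  have h3 : (3 : F) ≠ 0 := by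
    intro h
    have hd : ringChar F ∣ 3 := (ringChar.spec F 3).1 (by exact_mod_cast h)
    rcases (Nat.dvd_prime Nat.prime_three).1 hd with h1 | h1
    · have := (ringChar.spec F 1).2 (by rw [h1])
      simp at this
    · exact hchar h1
  have hρ0 := sq_add_self_add_one hρ
  have t := c.isCliffordTriple h3 hα hρ
  let Z := Subalgebra.center F c.Cliff
  have : IsScalarTower F Z c.Cliff := ⟨fun a z b ↦ smul_mul_assoc a (z : c.Cliff) b⟩
  have hval : Function.Injective (algebraMap Z c.Cliff) := Subtype.val_injective
  have : FaithfulSMul Z c.Cliff := (faithfulSMul_iff_algebraMap_injective _ _).2 hval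
  let W : Z := ⟨c.w ρ, t.wOf_mem_center h3 hα hρ0⟩
  let S : Z := ⟨c.yComp ρ 1 ^ 3, t.y₁_pow_three_mem_center h3 hα hρ0⟩
  have hWS := t.curve_equation (R := Z) (W := W) (S := S) h3 hα hρ0 rfl rfl
  obtain ⟨ψ, hr, hs⟩ := c.exists_coordRing_algHom hWS
  have hψr : (ψ (Ideal.Quotient.mk _ (MvPolynomial.X 0)) : c.Cliff) = c.w ρ := by rw [hr]
  have hψs : (ψ (Ideal.Quotient.mk _ (MvPolynomial.X 1)) : c.Cliff) = c.yComp ρ 1 ^ 3 := by rw [hs]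
  have hinj : Function.Injective ψ :=
    .of_comp (f := Z.val) (c.coordRing_algHom_injective h3 hα hρ0 (f := Z.val.comp ψ) hψr hψs)
  have hsurj : Function.Surjective ψ := c.coordRing_algHom_surjective h3 hα hρ hE hψr hψs
  let e := AlgEquiv.ofBijective ψ ⟨hinj, hsurj⟩
  refine ⟨le_antisymm (fun z hz ↦ ?_) (Algebra.adjoin_le ?_), ⟨e, hψr, hψs⟩, fun _ _ ↦ ?_⟩
  · obtain ⟨a, ha⟩ := hsurj ⟨z, hz⟩
    have hz' : z = Z.val.comp ψ a := (congrArg Subtype.val ha).symm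
    rw [hz']
    refine c.coordRing_apply_mem (Z.val.comp ψ) ?_ ?_ a
    · exact Algebra.subset_adjoin (.inr hψr)
    · exact Algebra.subset_adjoin (.inl hψs)
  · rintro _ (rfl | rfl)
    exacts [S.2, W.2]
  · obtain ⟨-, haz, hrk⟩ := t.center_and_azumaya (R := Z) (W := W) (S := S) h3 hα hρ0 rfl rfl
      (c.exists_smooth h3 hα hE hWS)
    obtain ⟨L, _, _, g, -, hg, hgs, -, -⟩ := c.exists_coordRing_model h3 hα hρ0
    have : IsDomain (c.CoordRing ρ) := hg.isDomain g.toRingHom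
    refine ⟨haz inferInstance, hrk inferInstance (e.symm.toMulEquiv.isDomain _) fun h ↦ hgs ?_⟩
    rw [h, ← map_zero ψ] at hs
    rw [hinj hs, map_zero]
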